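/- Let $$\mathcal{B}=\left\{\begin{bmatrix} a & b\\ b& a\end{bmatrix}: a,b\in\mathbb{C}\right\}\subseteq M_2(\mathbb{C}),\qquad \mathcal{W}_{3,2}=\left\{\begin{bmatrix} a & b\\ b& a\end{bmatrix}\oplus\begin{bmatrix} a & c\\ c& a\end{bmatrix}\oplus\begin{bmatrix} a & d\\ d& a\end{bmatrix}: a,b,c,d\in\mathbb{C}\right\}\subseteq M_6(\mathbb{C}),$$ so that $\mathcal{B}\cong\mathbb{C}^2$ as $C^*$-algebras and $\mathcal{W}_{3,2}$ is an operator system contained in the block-diagonal copy of $\mathcal{B}\oplus\mathcal{B}\oplus\mathcal{B}$ in $M_6(\mathbb{C})$. Let $$\mathcal{U}(\mathcal{W}_{3,2})=\left\{\begin{bmatrix}\lambda I_6 & x\\ 0&\lambda I_6\end{bmatrix}:\lambda\in\mathbb{C},\ x\in\mathcal{W}_{3,2}\right\}\subseteq M_2(M_6(\mathbb{C})),$$ a unital operator algebra contained in $M_2(\mathcal{B}\oplus\mathcal{B}\oplus\mathcal{B})$. Definitions. A $C^*$-cover of an operator system $\mathcal{S}$ (respectively, of a unital operator algebra $\mathcal{A}$)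 is a pair $(\mathcal{C},\rho)$ of a unital $C^*$-algebra $\mathcal{C}$ and a unital complete order embedding $\rho:\mathcal{S}\to\mathcal{C}$ (respectively, a unital completely isometric homomorphism $\rho:\mathcal{A}\to\mathcal{C}$) whose range generates $\mathcal{C}$ as a $C^*$-algebra. The $C^*$-envelope is the $C^*$-cover $(C^*_{\mathrm{env}},\iota)$ such that for every $C^*$-cover $(\mathcal{C},\rho)$ there is a unique surjective $*$-homomorphism $p:\mathcal{C}\to C^*_{\mathrm{env}}$ with $p\circ\rho=\iota$. An operator system $\mathcal{S}\subseteq\mathcal{C}$ (respectively, a unital operator algebra $\mathcal{A}\subseteq\mathcal{C}$) is hyperrigid in the unital $C^*$-algebra $\mathcal{C}$ if for every Hilbert space $H$ and every unital $*$-homomorphism $\pi:\mathcal{C}\to B(H)$, the restriction of $\pi$ to $\mathcal{S}$ (respectively, $\mathcal{A}$) has exactly one unital completely positive (respectively, unital completely contractive) extension to $\mathcal{C}$, and this extension is a $*$-homomorphism. Theorem. With the embeddings given by the above inclusions, $$C^*_{\mathrm{env}}(\mathcal{U}(\mathcal{W}_{3,2}))=M_2(\mathcal{B}\oplus\mathcal{B}\oplus\mathcal{B})\quad\text{and}\quad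 C^*_{\mathrm{env}}(\mathcal{W}_{3,2})=\mathcal{B}\oplus\mathcal{B}\oplus\mathcal{B};$$ moreover $\mathcal{U}(\mathcal{W}_{3,2})$ is hyperrigid in $M_2(\mathcal{B}\oplus\mathcal{B}\oplus\mathcal{B})$, and $\mathcal{W}_{3,2}$ is hyperrigid in $\mathcal{B}\oplus\mathcal{B}\oplus\mathcal{B}$. -/

import Mathlib

open scoped ComplexOrder CStarAlgebra

noncomputable section

/-! ### Operator systems, `C⋆`-covers, `C⋆`-envelopes, hyperrigidity -/

/-- A (concrete) operator system: a unital self-adjoint subspace of a unital `C⋆`-algebra.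
Its matrix order is the one inherited from the matrix algebras over the ambient algebra. -/
structure OperatorSystem (A : Type*) [CStarAlgebra A] extends Submodule ℂ A where
  one_mem' : (1 : A) ∈ carrier
  star_mem' : ∀ {x : A}, x ∈ carrier → star x ∈ carrier

section OperatorSystems

variable {A : Type*} [CStarAlgebra A] [PartialOrder A] [StarOrderedRing A]
variable {C : Type*} [CStarAlgebra C] [PartialOrder C] [StarOrderedRing C]

/-- `ρ` is a complete order isomorphism of `S` onto its image in `C`: a matrix over `S` is positive
if and only if its entrywise image is positive. -/
def IsCompleteOrderEmbedding (S : Submodule ℂ A) (ρ : S →ₗ[ℂ] C) : Prop :=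
  ∀ (n : ℕ) (M : Matrix (Fin n) (Fin n) S),
    0 ≤ CStarMatrix.ofMatrix (M.map fun s => (s : A)) ↔ 0 ≤ CStarMatrix.ofMatrix (M.map ρ)

/-- `(C, ρ)` is a `C⋆`-cover of the operator system `S`. -/
structure OperatorSystem.IsCStarCover (S : OperatorSystem A) (ρ : S.toSubmodule →ₗ[ℂ] C) :
    Prop where
  map_one : ρ ⟨1, S.one_mem'⟩ = 1
  completeOrder : IsCompleteOrderEmbedding S.toSubmodule ρ
  generates : (StarAlgebra.adjoin ℂ (Set.range ρ)).topologicalClosure = ⊤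

/-- `(C, ι)` is the `C⋆`-envelope of the operator system `S`: it is a `C⋆`-cover, and every
`C⋆`-cover `(D, ρ)` admits a unique `*`-epimorphism onto `C` which intertwines `ρ` and `ι`. -/
def OperatorSystem.IsCStarEnvelope.{u, a, c} {A : Type a} [CStarAlgebra A] [PartialOrder A]
    [StarOrderedRing A] {C : Type c} [CStarAlgebra C] [PartialOrder C] [StarOrderedRing C]
    (S : OperatorSystem A) (ι : S.toSubmodule →ₗ[ℂ] C) : Prop :=
  S.IsCStarCover ι ∧
    ∀ (D : Type u) [CStarAlgebra D] [PartialOrder D] [StarOrderedRing D]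
      (ρ : S.toSubmodule →ₗ[ℂ] D), S.IsCStarCover ρ →
        ∃! p : D →⋆ₐ[ℂ] C, Function.Surjective p ∧ ∀ s, p (ρ s) = ι s

/-- Unique extension property of a map `φ` on a subspace `S` of `C`: `φ` has exactly one
unital completely positive extension to `C`, and this extension is a `*`-homomorphism. -/
def HasUniqueUCPExtension {H : Type*} [NormedAddCommGroup H] [InnerProductSpace ℂ H]
    [CompleteSpace H] (S : Submodule ℂ C) (φ : S →ₗ[ℂ] (H →L[ℂ] H)) : Prop :=
  ∃ σ : C →⋆ₐ[ℂ] (H →L[ℂ] H), (∀ s : S, σ s = φ s) ∧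
    ∀ ψ : C →CP (H →L[ℂ] H), ψ 1 = 1 → (∀ s : S, ψ s = φ s) → ∀ x : C, ψ x = σ x

/-- Hyperrigidity in `C` of an operator system with underlying subspace `S`: the restriction to `S`
of every (unital) `*`-representation of `C` on a Hilbert space has the unique extension property. -/
def IsHyperrigidSystem.{v, c} {C : Type c} [CStarAlgebra C] [PartialOrder C] [StarOrderedRing C]
    (S : Submodule ℂ C) : Prop :=
  ∀ (H : Type v) [NormedAddCommGroup H] [InnerProductSpace ℂ H] [CompleteSpace H]
    (π : C →⋆ₐ[ℂ] (H →L[ℂ] H)),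
    HasUniqueUCPExtension S ((π : C →ₗ[ℂ] (H →L[ℂ] H)).domRestrict S)

end OperatorSystems

/-! ### Unital operator algebras -/

section OperatorAlgebras

variable {A : Type*} [CStarAlgebra A] [PartialOrder A] [StarOrderedRing A]
variable {C : Type*} [CStarAlgebra C] [PartialOrder C] [StarOrderedRing C]

/-- `(C, ρ)` is a `C⋆`-cover of the unital operator algebra `𝒜`: `ρ` is a unital completely
isometric homomorphism whose range generates `C` as a `C⋆`-algebra. -/
structure IsAlgCStarCover (𝒜 : Subalgebra ℂ A) (ρ : 𝒜 →ₐ[ℂ] C) : Prop where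
  completeIsometry : ∀ (n : ℕ) (M : Matrix (Fin n) (Fin n) 𝒜),
    ‖CStarMatrix.ofMatrix (M.map ρ)‖ = ‖CStarMatrix.ofMatrix (M.map fun s => (s : A))‖
  generates : (StarAlgebra.adjoin ℂ (Set.range ρ)).topologicalClosure = ⊤

/-- `(C, ι)` is the `C⋆`-envelope of the unital operator algebra `𝒜`. -/
def IsAlgCStarEnvelope.{u, a, c} {A : Type a} [CStarAlgebra A] [PartialOrder A]
    [StarOrderedRing A] {C : Type c} [CStarAlgebra C] [PartialOrder C] [StarOrderedRing C]
    (𝒜 : Subalgebra ℂ A) (ι : 𝒜 →ₐ[ℂ] C) : Prop :=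
  IsAlgCStarCover 𝒜 ι ∧
    ∀ (D : Type u) [CStarAlgebra D] [PartialOrder D] [StarOrderedRing D] (ρ : 𝒜 →ₐ[ℂ] D),
      IsAlgCStarCover 𝒜 ρ →
        ∃! p : D →⋆ₐ[ℂ] C, Function.Surjective p ∧ ∀ s, p (ρ s) = ι s

/-- A linear map between `C⋆`-algebras all of whose matrix amplifications are contractive. -/
def IsCompletelyContractive (ψ : A →ₗ[ℂ] C) : Prop :=
  ∀ (n : ℕ) (M : CStarMatrix (Fin n) (Fin n) A), ‖M.map ψ‖ ≤ ‖M‖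

/-- Unique extension property of a map `φ` on an operator algebra `𝒜` in `C`: `φ` has exactly one
unital completely contractive extension to `C`, and this extension is a `*`-homomorphism. -/
def HasUniqueUCCExtension {H : Type*} [NormedAddCommGroup H] [InnerProductSpace ℂ H]
    [CompleteSpace H] (𝒜 : Subalgebra ℂ C) (φ : 𝒜 →ₐ[ℂ] (H →L[ℂ] H)) : Prop :=
  ∃ σ : C →⋆ₐ[ℂ] (H →L[ℂ] H), (∀ s : 𝒜, σ s = φ s) ∧
    ∀ ψ : C →ₗ[ℂ] (H →L[ℂ] H), IsCompletelyContractive ψ → ψ 1 = 1 →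
      (∀ s : 𝒜, ψ s = φ s) → ∀ x : C, ψ x = σ x

/-- Hyperrigidity in `C` of a unital operator algebra `𝒜`: the restriction to `𝒜` of every (unital)
`*`-representation of `C` on a Hilbert space has the unique extension property. -/
def IsHyperrigidAlg.{v, c} {C : Type c} [CStarAlgebra C] [PartialOrder C] [StarOrderedRing C]
    (𝒜 : Subalgebra ℂ C) : Prop :=
  ∀ (H : Type v) [NormedAddCommGroup H] [InnerProductSpace ℂ H] [CompleteSpace H]
    (π : C →⋆ₐ[ℂ] (H →L[ℂ] H)),
    HasUniqueUCCExtension 𝒜 ((π : C →ₐ[ℂ] (H →L[ℂ] H)).comp 𝒜.val)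

/-- The operator algebra `𝒰(X) = {[λ, x; 0, λ] : λ ∈ ℂ, x ∈ X} ⊆ M₂(A)` of an operator space
`X ⊆ A`. -/
def upperAlg (X : Submodule ℂ A) : Subalgebra ℂ (CStarMatrix (Fin 2) (Fin 2) A) where
  carrier := {m | ∃ (l : ℂ) (x : A), x ∈ X ∧
    m = CStarMatrix.ofMatrix !![algebraMap ℂ A l, x; 0, algebraMap ℂ A l]}
  mul_mem' := by
    rintro _ _ ⟨l, x, hx, rfl⟩ ⟨k, y, hy, rfl⟩
    refine ⟨l * k, l • y + k • x, X.add_mem (X.smul_mem _ hy) (X.smul_mem _ hx), ?_⟩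
    ext i j
    fin_cases i <;> fin_cases j <;>
      simp [CStarMatrix.mul_apply, Algebra.smul_def, ← Algebra.commutes k x]
  add_mem' := by
    rintro _ _ ⟨l, x, hx, rfl⟩ ⟨k, y, hy, rfl⟩
    refine ⟨l + k, x + y, X.add_mem hx hy, ?_⟩
    ext i j
    fin_cases i <;> fin_cases j <;> simp
  algebraMap_mem' l := by
    refine ⟨l, 0, X.zero_mem, ?_⟩
    ext i j
    fin_cases i <;> fin_cases j <;> simp [CStarMatrix.algebraMap_apply]

end OperatorAlgebras

/-! ### The concrete objects -/

/-- The operator system `𝒲₃,₂ ⊆ M₆(ℂ)`. -/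
def W32 : OperatorSystem (CStarMatrix (Fin 6) (Fin 6) ℂ) where
  carrier := {m | ∃ a b c d : ℂ, m = CStarMatrix.ofMatrix
    !![a, b, 0, 0, 0, 0;
       b, a, 0, 0, 0, 0;
       0, 0, a, c, 0, 0;
       0, 0, c, a, 0, 0;
       0, 0, 0, 0, a, d;
       0, 0, 0, 0, d, a]}
  add_mem' := by
    rintro _ _ ⟨a, b, c, d, rfl⟩ ⟨a', b', c', d', rfl⟩
    refine ⟨a + a', b + b', c + c', d + d', ?_⟩
    ext i j
    fin_cases i <;> fin_cases j <;> simp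
  zero_mem' := by
    refine ⟨0, 0, 0, 0, ?_⟩
    ext i j
    fin_cases i <;> fin_cases j <;> simp
  smul_mem' := by
    rintro r _ ⟨a, b, c, d, rfl⟩
    refine ⟨r * a, r * b, r * c, r * d, ?_⟩
    ext i j
    fin_cases i <;> fin_cases j <;> simp
  one_mem' := by
    refine ⟨1, 0, 0, 0, ?_⟩
    ext i j
    fin_cases i <;> fin_cases j <;> simp
  star_mem' := by
    rintro _ ⟨a, b, c, d, rfl⟩
    refine ⟨star a, star b, star c, star d, ?_⟩
    ext i j
    fin_cases i <;> fin_cases j <;> simp [CStarMatrix.star_apply]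

/-- The `C⋆`-algebra `ℬ = {[a, b; b, a] : a, b ∈ ℂ} ⊆ M₂(ℂ)`. -/
def algB : StarSubalgebra ℂ (CStarMatrix (Fin 2) (Fin 2) ℂ) where
  carrier := {m | ∃ a b : ℂ, m = CStarMatrix.ofMatrix !![a, b; b, a]}
  mul_mem' := by
    rintro _ _ ⟨a, b, rfl⟩ ⟨a', b', rfl⟩
    refine ⟨a * a' + b * b', a * b' + b * a', ?_⟩
    ext i j
    fin_cases i <;> fin_cases j <;> simp [CStarMatrix.mul_apply, add_comm]
  add_mem' := by
    rintro _ _ ⟨a, b, rfl⟩ ⟨a', b', rfl⟩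
    refine ⟨a + a', b + b', ?_⟩
    ext i j
    fin_cases i <;> fin_cases j <;> simp
  algebraMap_mem' r := by
    refine ⟨r, 0, ?_⟩
    ext i j
    fin_cases i <;> fin_cases j <;> simp [CStarMatrix.algebraMap_apply]
  star_mem' := by
    rintro _ ⟨a, b, rfl⟩
    refine ⟨star a, star b, ?_⟩
    ext i j
    fin_cases i <;> fin_cases j <;> simp [CStarMatrix.star_apply]

instance algB_isClosed : IsClosed (algB : Set (CStarMatrix (Fin 2) (Fin 2) ℂ)) := by
  have : FiniteDimensional ℂ (CStarMatrix (Fin 2) (Fin 2) ℂ) :=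
    inferInstanceAs (FiniteDimensional ℂ (Matrix (Fin 2) (Fin 2) ℂ))
  exact (Subalgebra.toSubmodule algB.toSubalgebra).closed_of_finiteDimensional

/-- The order that a closed unital `*`-subalgebra inherits from the ambient algebra is its usual
order as a `C⋆`-algebra. -/
theorem starOrderedRing_of_isClosed {A : Type*} [CStarAlgebra A] [PartialOrder A]
    [StarOrderedRing A] (B : StarSubalgebra ℂ A) [IsClosed (B : Set A)] : StarOrderedRing B := by
  refine StarOrderedRing.of_nonneg_iff' (fun {x y} h z => ?_) fun x => ⟨fun h => ?_, ?_⟩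
  · change (z + x : A) ≤ z + y
    exact add_le_add_right (show (x : A) ≤ y from h) _
  · have hx : (0 : A) ≤ x := h
    have hs : IsSelfAdjoint (x : A) := .of_nonneg hx
    refine ⟨⟨cfc Real.sqrt (x : A), cfc_mem (𝕜' := ℂ) Real.sqrt x.2⟩, Subtype.ext ?_⟩
    change (x : A) = star (cfc Real.sqrt _) * cfc Real.sqrt _
    rw [← cfc_star, ← cfc_mul ..]
    conv_lhs => rw [← cfc_id ℝ (x : A)]
    refine cfc_congr fun t ht => ?_
    have := spectrum_nonneg_of_nonneg hx ht
    simp [Real.mul_self_sqrt this]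
  · rintro ⟨s, rfl⟩
    exact star_mul_self_nonneg (s : A)

instance algB_starOrderedRing : StarOrderedRing algB :=
  starOrderedRing_of_isClosed algB

/-- The block-diagonal inclusion `ℬ ⊕ ℬ ⊕ ℬ ⊆ M₆(ℂ)`, with the `k`-th summand in rows and columns
`2k, 2k + 1` (counting from `0`). -/
def blockIncl : (Fin 3 → algB) →⋆ₐ[ℂ] CStarMatrix (Fin 6) (Fin 6) ℂ where
  toFun b := CStarMatrix.ofMatrix (Matrix.of fun p q : Fin (3 * 2) =>
    if p.divNat = q.divNat then
      (b p.divNat : CStarMatrix (Fin 2) (Fin 2) ℂ) p.modNat q.modNat else 0)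
  map_one' := by
    ext i j
    fin_cases i <;> fin_cases j <;> rfl
  map_mul' x y := by
    ext i j
    rw [CStarMatrix.mul_apply]
    change _ = ∑ k : Fin (3 * 2), _
    rw [← finProdFinEquiv.sum_comp, Fintype.sum_prod_type]
    have h1 : ∀ (a : Fin 3) (b : Fin 2), (finProdFinEquiv (a, b)).divNat = a := fun a b =>
      congrArg Prod.fst (finProdFinEquiv.symm_apply_apply (a, b))
    have h2 : ∀ (a : Fin 3) (b : Fin 2), (finProdFinEquiv (a, b)).modNat = b := fun a b =>
      congrArg Prod.snd (finProdFinEquiv.symm_apply_apply (a, b))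
    by_cases h : (Fin.divNat (m := 3) (n := 2) i) = Fin.divNat (m := 3) (n := 2) j
    · simp [h1, h2, h, CStarMatrix.mul_apply]
    · simp [h1, h2, h]
  map_zero' := by
    ext i j
    simp
  map_add' x y := by
    ext i j
    by_cases h : (Fin.divNat (m := 3) (n := 2) i) = Fin.divNat (m := 3) (n := 2) j <;>
      simp [h]
  commutes' r := by
    ext i j
    have h3 : i = j ↔ Fin.divNat (m := 3) (n := 2) i = Fin.divNat (m := 3) (n := 2) j ∧
        Fin.modNat (m := 3) (n := 2) i = Fin.modNat (m := 3) (n := 2) j := by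
      revert i j
      decide
    by_cases h : (Fin.divNat (m := 3) (n := 2) i) = Fin.divNat (m := 3) (n := 2) j <;>
      simp [CStarMatrix.algebraMap_apply, h3, h]
  map_star' x := by
    ext i j
    by_cases h : (Fin.divNat (m := 3) (n := 2) i) = Fin.divNat (m := 3) (n := 2) j
    · simp [CStarMatrix.star_apply, h]
    · simp [CStarMatrix.star_apply, h, Ne.symm h]

end

universe u v

open scoped InnerProductSpace ComplexStarModule

section UnitalContractions

variable {A B : Type*} [CStarAlgebra A] [CStarAlgebra B]

theorem norm_sq_add_I_smul_one_le {a : A} (ha : IsSelfAdjoint a) (t : ℝ) :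
    ‖a + (t * Complex.I : ℂ) • (1 : A)‖ ^ 2 ≤ ‖a‖ ^ 2 + t ^ 2 := by
  have h1 : star (a + (t * Complex.I : ℂ) • (1 : A)) * (a + (t * Complex.I : ℂ) • (1 : A))
      = a * a + ((t ^ 2 : ℝ) : ℂ) • (1 : A) := by
    have h2 : (t * Complex.I : ℂ) * (t * Complex.I) = -((t : ℂ) ^ 2) := by
      linear_combination (t : ℂ) ^ 2 * Complex.I_mul_I
    have h3 : star (t * Complex.I : ℂ) = -(t * Complex.I) := by simp
    rw [star_add, ha.star_eq, star_smul, star_one, h3, add_mul, mul_add, mul_add, smul_mul_smul_comm,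
      neg_mul, h2]
    simp only [neg_smul, neg_mul, Algebra.smul_mul_assoc, Algebra.mul_smul_comm, mul_one, one_mul,
      neg_neg]
    push_cast
    abel
  rcases subsingleton_or_nontrivial A with hA | hA
  · simp only [Subsingleton.elim _ (0 : A), norm_zero]; nlinarith [sq_nonneg t]
  rw [sq, ← CStarRing.norm_star_mul_self, h1]
  refine (norm_add_le _ _).trans ?_
  rw [norm_smul, norm_one, mul_one, Complex.norm_real, Real.norm_of_nonneg (sq_nonneg t), sq ‖a‖]
  gcongr
  exact norm_mul_le _ _

theorem LinearMap.isSelfAdjoint_of_unital_contractive (T : A →ₗ[ℂ] B) (h1 : T 1 = 1)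
    (hT : ∀ x, ‖T x‖ ≤ ‖x‖) {a : A} (ha : IsSelfAdjoint a) : IsSelfAdjoint (T a) := by
  have key : ∀ t : ℝ, ‖(ℑ (T a) : B) + (t : ℂ) • (1 : B)‖ ^ 2 ≤ ‖a‖ ^ 2 + t ^ 2 := by
    intro t
    refine le_trans ?_ (norm_sq_add_I_smul_one_le ha t)
    have h2 : (ℑ (T (a + (t * Complex.I : ℂ) • (1 : A))) : B) = ℑ (T a) + (t : ℂ) • (1 : B) := by
      have h3 : (t * Complex.I : ℂ) • (1 : B) = Complex.I • ((t : ℂ) • (1 : B)) := by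
        rw [smul_smul, mul_comm]
      rw [map_add, map_smul, h1, map_add, h3, imaginaryPart_I_smul]
      simp
    rw [← h2]
    gcongr
    exact (imaginaryPart.norm_le _).trans (hT _)
  have hy : (ℑ (T a) : B) = 0 := by
    by_contra hne
    have : Nontrivial B := ⟨_, _, hne⟩
    have hpos : 0 < ‖(ℑ (T a) : B)‖ := norm_pos_iff.2 hne
    obtain ⟨l, hl, hls⟩ : ∃ l : ℝ, l ≠ 0 ∧ l ∈ spectrum ℝ (ℑ (T a) : B) := by
      rcases CStarAlgebra.norm_or_neg_norm_mem_spectrum (a := (ℑ (T a) : B)) (ℑ (T a)).2 with h | h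
      exacts [⟨_, hpos.ne', h⟩, ⟨_, (neg_neg_of_pos hpos).ne, h⟩]
    set t : ℝ := (‖a‖ ^ 2 + 1) / (2 * l)
    have h5 : l + t ∈ spectrum ℝ ((ℑ (T a) : B) + (t : ℂ) • (1 : B)) := by
      rw [Complex.coe_smul, ← Algebra.algebraMap_eq_smul_one]
      rw [add_comm (ℑ (T a) : B)]
      exact spectrum.add_mem_add_iff.2 hls
    have h6 : ‖l + t‖ ≤ _ := spectrum.norm_le_norm_of_mem h5
    have h7 := key t
    have h8 : (l + t) ^ 2 ≤ ‖a‖ ^ 2 + t ^ 2 := by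
      refine le_trans ?_ h7
      rw [← sq_abs, ← Real.norm_eq_abs]
      gcongr
    have h9 : 2 * l * t = ‖a‖ ^ 2 + 1 := by
      simp only [t]; field_simp
    nlinarith [sq_nonneg l]
  have := realPart_add_I_smul_imaginaryPart (T a)
  rw [hy, smul_zero, add_zero] at this
  rw [← this]
  exact (ℜ (T a)).2

variable [PartialOrder A] [StarOrderedRing A] [PartialOrder B] [StarOrderedRing B]

/-- A unital contractive linear map between `C⋆`-algebras is positive. -/
theorem LinearMap.map_nonneg_of_unital_contractive (T : A →ₗ[ℂ] B) (h1 : T 1 = 1)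
    (hT : ∀ x, ‖T x‖ ≤ ‖x‖) {a : A} (ha : 0 ≤ a) : 0 ≤ T a := by
  have hs : IsSelfAdjoint (T a) := T.isSelfAdjoint_of_unital_contractive h1 hT (.of_nonneg ha)
  have h2 : ‖algebraMap ℝ A ‖a‖ - a‖ ≤ ‖a‖ := by
    refine (CStarAlgebra.norm_le_iff_le_algebraMap _ (norm_nonneg a) ?_).2 ?_
    · exact sub_nonneg.2 (IsSelfAdjoint.le_algebraMap_norm_self (.of_nonneg ha))
    · exact sub_le_self _ ha
  have h3 : T (algebraMap ℝ A ‖a‖ - a) = algebraMap ℝ B ‖a‖ - T a := by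
    rw [map_sub, Algebra.algebraMap_eq_smul_one, Algebra.algebraMap_eq_smul_one,
      ← Complex.coe_smul, ← Complex.coe_smul, map_smul, h1]
  have h4 : ‖algebraMap ℝ B ‖a‖ - T a‖ ≤ ‖a‖ := h3 ▸ (hT _).trans h2
  have h5 : algebraMap ℝ B ‖a‖ - T a ≤ algebraMap ℝ B ‖a‖ :=
    (IsSelfAdjoint.le_algebraMap_norm_self ((IsSelfAdjoint.algebraMap B (.all _)).sub hs)).trans
      (algebraMap_mono B h4)
  simpa using h5

/-- A unital completely contractive map is completely positive. -/
def IsCompletelyContractive.toCompletelyPositiveMap {ψ : A →ₗ[ℂ] B}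
    (hψ : IsCompletelyContractive ψ) (h1 : ψ 1 = 1) : A →CP B where
  toLinearMap := ψ
  map_cstarMatrix_nonneg' k M hM := by
    refine LinearMap.map_nonneg_of_unital_contractive (CStarMatrix.mapₗ ψ) ?_ (hψ k) hM
    ext i j
    by_cases h : i = j
    · subst h; simp [CStarMatrix.mapₗ, h1]
    · simp [CStarMatrix.mapₗ, h]

/-- Every positive element of a nonzero unital `C⋆`-algebra attains its norm at a state. -/
theorem exists_state_apply_eq_norm [Nontrivial A] {z : A} (hz : 0 ≤ z) :
    ∃ f : A →ₚ[ℂ] ℂ, f 1 = 1 ∧ f z = (‖z‖ : ℂ) := by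
  have h1 : ‖(1 : A) + z‖ = 1 + ‖z‖ := by
    refine le_antisymm ((norm_add_le _ _).trans (by simp)) ?_
    have h2 : ‖z‖ + 1 ∈ spectrum ℝ (z + algebraMap ℝ A 1) := by
      rw [add_comm z]
      exact spectrum.add_mem_add_iff.2 (CStarAlgebra.norm_mem_spectrum_of_nonneg hz)
    have h3 := spectrum.norm_le_norm_of_mem h2
    rw [map_one, Real.norm_of_nonneg (by positivity)] at h3
    rwa [add_comm, add_comm 1 z]
  have hne : (1 : A) + z ≠ 0 := by
    intro h; rw [h, norm_zero] at h1; linarith [norm_nonneg z]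
  obtain ⟨g, hg, hgz⟩ := exists_dual_vector ℂ _ (norm_ne_zero_iff.2 hne)
  have hle : ∀ x, ‖g x‖ ≤ ‖x‖ := fun x => by simpa [hg] using g.le_opNorm x
  have hre : (g 1).re + (g z).re = 1 + ‖z‖ := by
    rw [← Complex.add_re, ← map_add, hgz, h1]; simp
  have e1 : ‖g 1‖ ≤ 1 := by simpa using hle 1
  have e2 := hle z
  have e3 := Complex.re_le_norm (g 1)
  have e4 := Complex.re_le_norm (g z)
  have aux : ∀ (w : ℂ) (r : ℝ), ‖w‖ ≤ r → w.re = r → w = r := by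
    intro w r h h'
    have : w.re = ‖w‖ := le_antisymm (Complex.re_le_norm w) (h' ▸ h)
    have h'' := Complex.eq_coe_norm_of_nonneg (Complex.re_eq_norm.1 this)
    rw [h'', ← this, h']
  have g1 : g 1 = 1 := by simpa using aux _ _ e1 (by linarith)
  have gz : g z = ‖z‖ := aux _ _ e2 (by linarith)
  exact ⟨PositiveLinearMap.mk₀ (g : A →ₗ[ℂ] ℂ) fun x hx =>
    LinearMap.map_nonneg_of_unital_contractive (g : A →ₗ[ℂ] ℂ) g1 hle hx, g1, gz⟩

/-- The GNS representation of a state attaining the norm of `star x * x`: some unit vector realises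
the norm of `x`. -/
theorem exists_rep_norm_apply_eq.{w} {D : Type w} [CStarAlgebra D] [PartialOrder D]
    [StarOrderedRing D] [Nontrivial D] (x : D) :
    ∃ (H : Type w) (_ : NormedAddCommGroup H) (_ : InnerProductSpace ℂ H) (_ : CompleteSpace H)
      (π : D →⋆ₐ[ℂ] (H →L[ℂ] H)) (h : H), ‖h‖ = 1 ∧ ‖π x h‖ = ‖x‖ := by
  obtain ⟨f, f1, fx⟩ := exists_state_apply_eq_norm (star_mul_self_nonneg x)
  refine ⟨f.GNS, inferInstance, inferInstance, inferInstance, f.gnsStarAlgHom,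
    (f.toPreGNS 1 : f.GNS), ?_, ?_⟩
  · rw [UniformSpace.Completion.norm_coe, f.preGNS_norm_def]; simp [f1]
  · have : f.gnsStarAlgHom x (f.toPreGNS 1 : f.GNS) = (f.toPreGNS x : f.GNS) := by
      simp
    rw [this, UniformSpace.Completion.norm_coe, f.preGNS_norm_def]
    simp [fx, CStarRing.norm_star_mul_self]

end UnitalContractions

section MultiplicativeDomain

variable {H : Type*} [NormedAddCommGroup H] [InnerProductSpace ℂ H] [CompleteSpace H]

theorem CStarAlgebra.exists_eq_star_mul_self {A : Type*} [NonUnitalCStarAlgebra A]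
    [PartialOrder A] [StarOrderedRing A] {x : A} (hx : 0 ≤ x) : ∃ y : A, x = star y * y :=
  CStarAlgebra.nonneg_iff_eq_star_mul_self.1 hx

/-- A positive operator matrix is positive as a quadratic form, and annihilates the isotropic
vectors of that form. -/
theorem CStarMatrix.form_nonneg_and_apply_eq_zero {n : Type*} [Fintype n]
    {M : CStarMatrix n n (H →L[ℂ] H)} (hM : 0 ≤ M) (v : n → H) :
    0 ≤ ∑ i, ⟪v i, ∑ j, M i j (v j)⟫_ℂ ∧
      (∑ i, ⟪v i, ∑ j, M i j (v j)⟫_ℂ = 0 → ∀ i, ∑ j, M i j (v j) = 0) := by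
  classical
  obtain ⟨N, rfl⟩ := CStarAlgebra.exists_eq_star_mul_self hM
  have h1 : ∀ i, ∑ j, (star N * N) i j (v j) = ∑ k, star (N k i) (∑ j, N k j (v j)) := by
    intro i
    simp only [CStarMatrix.mul_apply, CStarMatrix.star_apply, _root_.sum_apply,
      mul_apply_eq_comp, map_sum]
    exact Finset.sum_comm
  have h2 : ∑ i, ⟪v i, ∑ j, (star N * N) i j (v j)⟫_ℂ
      = ((∑ k, ‖∑ j, N k j (v j)‖ ^ 2 : ℝ) : ℂ) := by
    simp only [h1, inner_sum]
    rw [Finset.sum_comm]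
    push_cast
    refine Finset.sum_congr rfl fun k _ => ?_
    simp only [ContinuousLinearMap.star_eq_adjoint, ContinuousLinearMap.adjoint_inner_right]
    rw [← sum_inner, inner_self_eq_norm_sq_to_K]
    rfl
  rw [h2]
  refine ⟨?_, fun h i => ?_⟩
  · rw [Complex.zero_le_real]; positivity
  · rw [Complex.ofReal_eq_zero, Finset.sum_eq_zero_iff_of_nonneg fun _ _ => by positivity] at h
    rw [h1]
    refine Finset.sum_eq_zero fun k _ => ?_
    have := h k (Finset.mem_univ k)
    rw [sq_eq_zero_iff, norm_eq_zero] at this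
    rw [this, map_zero]

variable {C : Type*} [CStarAlgebra C] [PartialOrder C] [StarOrderedRing C]

/-- The matrix `(ψ (star (v i) * v j))` is positive. -/
theorem CompletelyPositiveMap.gram_nonneg (ψ : C →CP (H →L[ℂ] H)) {n : ℕ} (v : Fin n → C) :
    0 ≤ CStarMatrix.ofMatrix (Matrix.of fun i j => ψ (star (v i) * v j)) := by
  classical
  rcases n with _ | n
  · exact le_of_eq (by ext i; exact i.elim0)
  let N : CStarMatrix (Fin (n + 1)) (Fin (n + 1)) C :=
    CStarMatrix.ofMatrix (Matrix.of fun k j => if k = 0 then v j else 0)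
  have h := ψ.map_cstarMatrix_nonneg' (n + 1) _ (star_mul_self_nonneg N)
  change 0 ≤ CStarMatrix.map _ ψ at h
  convert h using 1
  ext1 i j
  simp [N, CStarMatrix.mul_apply, CStarMatrix.star_apply]

/-- The Kadison–Schwarz inequality. -/
theorem CompletelyPositiveMap.schwarz (ψ : C →CP (H →L[ℂ] H)) (h1 : ψ 1 = 1) (a : C) :
    star (ψ a) * ψ a ≤ ψ (star a * a) := by
  rw [ContinuousLinearMap.le_def, ContinuousLinearMap.isPositive_iff_complex]
  intro h
  have := (CStarMatrix.form_nonneg_and_apply_eq_zero (ψ.gram_nonneg ![1, a]) ![-ψ a h, h]).1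
  have h2 : 0 ≤ ⟪h, (ψ (star a * a) - star (ψ a) * ψ a) h⟫_ℂ := by
    simpa [Fin.sum_univ_two, h1, map_star, ContinuousLinearMap.star_eq_adjoint,
      ContinuousLinearMap.adjoint_inner_right, inner_sub_right] using this
  rw [← inner_conj_symm, starRingEnd_apply, h2.star_eq]
  exact ⟨Complex.conj_eq_iff_re.1 h2.star_eq, h2.1⟩

theorem CompletelyPositiveMap.schwarz_star (ψ : C →CP (H →L[ℂ] H)) (h1 : ψ 1 = 1) (a : C) :
    ψ a * star (ψ a) ≤ ψ (a * star a) := by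
  have := ψ.schwarz h1 (star a)
  rwa [map_star, star_star, star_star] at this

/-- Choi's theorem: an element at which the Schwarz inequality is an equality is right
multiplicative. -/
theorem CompletelyPositiveMap.map_mul_of_schwarz_eq (ψ : C →CP (H →L[ℂ] H)) (h1 : ψ 1 = 1) {a : C}
    (ha : ψ (star a * a) = star (ψ a) * ψ a) (x : C) : ψ (x * a) = ψ x * ψ a := by
  ext h
  have := (CStarMatrix.form_nonneg_and_apply_eq_zero (ψ.gram_nonneg ![1, a, star x])
    ![-ψ a h, h, 0]).2 ?_ 2
  · simp [Fin.sum_univ_three] at this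
    simpa using (neg_add_eq_zero.1 this).symm
  · simp [Fin.sum_univ_three, h1, ha, map_star]

/-- The elements on which `ψ` agrees with the representation `π` and is multiplicative. -/
def CompletelyPositiveMap.agreement (ψ : C →CP (H →L[ℂ] H)) (π : C →⋆ₐ[ℂ] (H →L[ℂ] H))
    (h1 : ψ 1 = 1) : StarSubalgebra ℂ C where
  carrier := {a | ψ a = π a ∧ ∀ x, ψ (x * a) = ψ x * π a ∧ ψ (a * x) = π a * ψ x}
  mul_mem' := by
    rintro a b ⟨ha, ha'⟩ ⟨hb, hb'⟩
    refine ⟨by rw [(hb' a).1, ha, map_mul], fun x => ⟨?_, ?_⟩⟩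
    · rw [← mul_assoc, (hb' _).1, (ha' _).1, map_mul, mul_assoc]
    · rw [mul_assoc, (ha' _).2, (hb' _).2, map_mul, mul_assoc]
  add_mem' := by
    rintro a b ⟨ha, ha'⟩ ⟨hb, hb'⟩
    refine ⟨by rw [map_add, ha, hb, map_add], fun x => ⟨?_, ?_⟩⟩
    · rw [mul_add, map_add, (ha' x).1, (hb' x).1, map_add, mul_add]
    · rw [add_mul, map_add, (ha' x).2, (hb' x).2, map_add, add_mul]
  algebraMap_mem' r := by
    simp [Algebra.algebraMap_eq_smul_one, h1]
  star_mem' := by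
    rintro a ⟨ha, ha'⟩
    refine ⟨by rw [map_star, ha, map_star], fun x => ⟨?_, ?_⟩⟩
    · rw [← star_star (x * star a), map_star, star_mul, star_star, (ha' _).2, star_mul, map_star,
        star_star, map_star]
    · rw [← star_star (star a * x), map_star, star_mul, star_star, (ha' _).1, star_mul, map_star,
        star_star, map_star]

theorem CompletelyPositiveMap.mem_agreement {ψ : C →CP (H →L[ℂ] H)} {π : C →⋆ₐ[ℂ] (H →L[ℂ] H)}
    {h1 : ψ 1 = 1} {a : C} (ha : ψ a = π a) (hl : ψ (star a * a) = π (star a * a))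
    (hr : ψ (a * star a) = π (a * star a)) : a ∈ ψ.agreement π h1 := by
  refine ⟨ha, fun x => ⟨?_, ?_⟩⟩
  · rw [← ha]
    exact ψ.map_mul_of_schwarz_eq h1 (by rw [hl, map_mul, ha, map_star]) x
  · have := ψ.map_mul_of_schwarz_eq h1 (a := star a)
      (by rw [star_star, hr, map_mul, map_star, map_star, ha, star_star]) (star x)
    rw [← star_mul, map_star, map_star, map_star, ← star_mul, star_inj, ha] at this
    exact this

theorem CompletelyPositiveMap.eq_of_agreement_eq_top {ψ : C →CP (H →L[ℂ] H)}
    {π : C →⋆ₐ[ℂ] (H →L[ℂ] H)} {h1 : ψ 1 = 1} (h : ψ.agreement π h1 = ⊤) (x : C) : ψ x = π x :=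
  (h ▸ StarSubalgebra.mem_top : x ∈ ψ.agreement π h1).1

end MultiplicativeDomain

section Compression

variable {D : Type*} [CStarAlgebra D]

theorem StarAlgHom.eq_of_eqOn_generators {C : Type*} [CStarAlgebra C] {S : Set D}
    (hS : (StarAlgebra.adjoin ℂ S).topologicalClosure = ⊤) {p q : D →⋆ₐ[ℂ] C}
    (h : Set.EqOn p q S) : p = q := by
  have h1 : (StarAlgebra.adjoin ℂ S).topologicalClosure ≤ StarAlgHom.equalizer p q :=
    StarSubalgebra.topologicalClosure_minimal (StarAlgebra.adjoin_le fun x hx => h hx)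
      (isClosed_eq (map_continuous p) (map_continuous q))
  rw [hS] at h1
  ext x
  exact h1 (StarSubalgebra.mem_top (x := x))

theorem StarAlgHom.surjective_of_generators_subset_range {C : Type*} [CStarAlgebra C] {S : Set C}
    (hS : StarAlgebra.adjoin ℂ S = ⊤) (p : D →⋆ₐ[ℂ] C) (h : S ⊆ Set.range p) :
    Function.Surjective p := by
  have h1 : StarAlgebra.adjoin ℂ S ≤ p.range := StarAlgebra.adjoin_le h
  rw [hS] at h1
  exact fun x => h1 (StarSubalgebra.mem_top (x := x))

variable {H : Type*} [NormedAddCommGroup H] [InnerProductSpace ℂ H] [CompleteSpace H]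

/-- The elements of `D` that leave a subspace invariant together with their adjoints. -/
def StarAlgHom.reducing (π : D →⋆ₐ[ℂ] (H →L[ℂ] H)) (V : Submodule ℂ H) : StarSubalgebra ℂ D where
  carrier := {x | ∀ v ∈ V, π x v ∈ V ∧ π (star x) v ∈ V}
  mul_mem' := by
    intro x y hx hy v hv
    rw [star_mul, map_mul, map_mul]
    exact ⟨(hx _ (hy v hv).1).1, (hy _ (hx v hv).2).2⟩
  add_mem' := by
    intro x y hx hy v hv
    rw [star_add, map_add, map_add]
    exact ⟨V.add_mem (hx v hv).1 (hy v hv).1, V.add_mem (hx v hv).2 (hy v hv).2⟩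
  algebraMap_mem' r := by
    intro v hv
    rw [← algebraMap_star_comm, AlgHomClass.commutes, AlgHomClass.commutes,
      Algebra.algebraMap_eq_smul_one, Algebra.algebraMap_eq_smul_one]
    exact ⟨V.smul_mem _ hv, V.smul_mem _ hv⟩
  star_mem' := by
    intro x hx v hv
    rw [star_star]
    exact (hx v hv).symm

theorem StarAlgHom.isClosed_reducing (π : D →⋆ₐ[ℂ] (H →L[ℂ] H)) (V : Submodule ℂ H)
    [FiniteDimensional ℂ V] : IsClosed (π.reducing V : Set D) := by
  have hV : IsClosed (V : Set H) := V.closed_of_finiteDimensional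
  have hc : ∀ v, Continuous fun x => π x v := fun v =>
    (ContinuousLinearMap.apply ℂ H v).continuous.comp (map_continuous π)
  have : (π.reducing V : Set D) =
      ⋂ v ∈ V, {x | π x v ∈ V} ∩ {x | π (star x) v ∈ V} := by
    ext x; simp [StarAlgHom.reducing, ← SetLike.mem_coe]
  rw [this]
  exact isClosed_biInter fun v _ => (hV.preimage (hc v)).inter
    (hV.preimage ((hc v).comp continuous_star))

/-- The compression of a representation to a finite-dimensional reducing subspace, written in an
orthonormal basis of that subspace. -/
theorem StarAlgHom.exists_compression {S : Set D}
    (hS : (StarAlgebra.adjoin ℂ S).topologicalClosure = ⊤) (π : D →⋆ₐ[ℂ] (H →L[ℂ] H)) {n : ℕ}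
    {e : Fin n → H} (he : Orthonormal ℂ e)
    (hinv : ∀ x ∈ S, ∀ j, π x (e j) ∈ Submodule.span ℂ (Set.range e) ∧
      π (star x) (e j) ∈ Submodule.span ℂ (Set.range e)) :
    ∃ P : D →⋆ₐ[ℂ] CStarMatrix (Fin n) (Fin n) ℂ, ∀ x i j, P x i j = ⟪e i, π x (e j)⟫_ℂ := by
  set V := Submodule.span ℂ (Set.range e) with hV
  have : FiniteDimensional ℂ V := FiniteDimensional.span_of_finite ℂ (Set.finite_range e)
  have h1 : (StarAlgebra.adjoin ℂ S).topologicalClosure ≤ π.reducing V := by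
    refine StarSubalgebra.topologicalClosure_minimal (StarAlgebra.adjoin_le fun x hx v hv => ?_)
      (π.isClosed_reducing V)
    refine ⟨?_, ?_⟩
    · have : V ≤ V.comap (π x : H →ₗ[ℂ] H) := by
        conv_lhs => rw [hV]
        rw [Submodule.span_le]
        rintro _ ⟨j, rfl⟩
        exact (hinv x hx j).1
      exact this hv
    · have : V ≤ V.comap (π (star x) : H →ₗ[ℂ] H) := by
        conv_lhs => rw [hV]
        rw [Submodule.span_le]
        rintro _ ⟨j, rfl⟩
        exact (hinv x hx j).2
      exact this hv
  rw [hS] at h1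
  have h2 : ∀ x j, π x (e j) = ∑ k, ⟪e k, π x (e j)⟫_ℂ • e k := by
    intro x j
    have h3 : π x (e j) ∈ V :=
      (h1 (StarSubalgebra.mem_top (x := x)) _ (Submodule.subset_span ⟨j, rfl⟩)).1
    obtain ⟨c, hc⟩ := (Submodule.mem_span_range_iff_exists_fun ℂ).1 h3
    rw [← hc]
    exact Finset.sum_congr rfl fun k _ => by rw [he.inner_right_fintype]
  refine ⟨
    { toFun := fun x => CStarMatrix.ofMatrix (Matrix.of fun i j => ⟪e i, π x (e j)⟫_ℂ)
      map_one' := ?_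
      map_mul' := ?_
      map_zero' := ?_
      map_add' := ?_
      commutes' := ?_
      map_star' := ?_ }, fun _ _ _ => rfl⟩
  · ext i j
    simp [orthonormal_iff_ite.1 he, CStarMatrix.one_apply]
  · intro x y
    ext i j
    rw [CStarMatrix.mul_apply]
    simp only [CStarMatrix.ofMatrix_apply, Matrix.of_apply, map_mul, mul_apply_eq_comp]
    conv_lhs => rw [h2 y j]
    simp only [map_sum, map_smul, inner_sum, inner_smul_right]
    exact Finset.sum_congr rfl fun k _ => mul_comm _ _
  · ext i j
    simp
  · intro x y
    ext i j
    simp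
  · intro r
    ext i j
    simp [CStarMatrix.algebraMap_apply, Algebra.algebraMap_eq_smul_one,
      orthonormal_iff_ite.1 he]
  · intro x
    ext i j
    rw [CStarMatrix.star_apply]
    simp only [CStarMatrix.ofMatrix_apply, Matrix.of_apply, map_star,
      ContinuousLinearMap.star_eq_adjoint, ContinuousLinearMap.adjoint_inner_right]
    simp

end Compression

section Rigidity

variable {H : Type*} [NormedAddCommGroup H] [InnerProductSpace ℂ H]

theorem eq_of_norm_add_eq_two {u v : H} (hu : ‖u‖ ≤ 1) (hv : ‖v‖ ≤ 1) (h : ‖u + v‖ = 2) :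
    u = v := by
  have := parallelogram_law_with_norm ℂ u v
  rw [h] at this
  have h0 : ‖u - v‖ = 0 := by
    nlinarith [norm_nonneg (u - v), norm_nonneg u, norm_nonneg v]
  exact sub_eq_zero.1 (norm_eq_zero.1 h0)

theorem eq_zero_of_norm_add_le_one {u v : H} (hu : ‖u‖ = 1) (h1 : ‖u + v‖ ≤ 1)
    (h2 : ‖u - v‖ ≤ 1) : v = 0 := by
  have := parallelogram_law_with_norm ℂ u v
  rw [hu] at this
  have h0 : ‖v‖ = 0 := by
    nlinarith [norm_nonneg (u - v), norm_nonneg (u + v), norm_nonneg v]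
  exact norm_eq_zero.1 h0

variable [CompleteSpace H]

theorem ContinuousLinearMap.star_apply_apply_eq_self {T : H →L[ℂ] H} (hT : ‖T‖ ≤ 1) {h : H}
    (hh : ‖h‖ = 1) (hTh : ‖T h‖ = 1) : star T (T h) = h := by
  have h1 : ‖star T (T h)‖ ≤ 1 := by
    refine ((star T).le_opNorm _).trans ?_
    rw [norm_star, hTh, mul_one]; exact hT
  have h2 : ⟪star T (T h), h⟫_ℂ = 1 := by
    rw [ContinuousLinearMap.star_eq_adjoint, ContinuousLinearMap.adjoint_inner_left,
      inner_self_eq_norm_sq_to_K, hTh]; simp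
  have h3 := norm_sub_sq (𝕜 := ℂ) (star T (T h)) h
  rw [h2, hh] at h3
  have h4 : ‖star T (T h) - h‖ = 0 := by
    simp at h3
    nlinarith [norm_nonneg (star T (T h) - h), norm_nonneg (star T (T h))]
  exact sub_eq_zero.1 (norm_eq_zero.1 h4)

variable {D : Type*} [CStarAlgebra D]

theorem StarAlgHom.norm_apply_apply_le_one (π : D →⋆ₐ[ℂ] (H →L[ℂ] H)) {x : D} (hx : ‖x‖ ≤ 1) {h : H}
    (hh : ‖h‖ = 1) : ‖π x h‖ ≤ 1 := by
  refine ((π x).le_opNorm _).trans ?_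
  rw [hh, mul_one]
  exact (NonUnitalStarAlgHom.norm_apply_le π x).trans hx

end Rigidity

section Characters

variable {D : Type*} [CStarAlgebra D] [PartialOrder D] [StarOrderedRing D] [Nontrivial D]

/-- Self-adjoint generators that are pairwise incompatible in norm have characters which
concentrate on one of them. -/
theorem exists_character_of_norm_eq_two {ι : Type*} {s : ι → D} (hsa : ∀ k, IsSelfAdjoint (s k))
    (hgen : (StarAlgebra.adjoin ℂ (Set.range s)).topologicalClosure = ⊤) (hs : ∀ k, ‖s k‖ ≤ 1)
    {k : ι} (hadd : ∀ l, l ≠ k → ‖s k + s l‖ ≤ 1) (hsub : ∀ l, l ≠ k → ‖s k - s l‖ ≤ 1)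
    {ε : ℂ} (hε : ε = 1 ∨ ε = -1) (h2 : ‖1 + ε • s k‖ = 2) :
    ∃ χ : D →⋆ₐ[ℂ] CStarMatrix (Fin 1) (Fin 1) ℂ, χ (s k) 0 0 = ε ∧
      ∀ l, l ≠ k → χ (s l) 0 0 = 0 := by
  obtain ⟨H, _, _, _, π, h, hh, hx⟩ := exists_rep_norm_apply_eq (1 + ε • s k)
  have hεε : ε * ε = 1 := by rcases hε with rfl | rfl <;> simp
  have hεn : ‖ε‖ = 1 := by rcases hε with rfl | rfl <;> simp
  have hk1 := π.norm_apply_apply_le_one (hs k) hh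
  have hk : π (s k) h = ε • h := by
    have : h = ε • π (s k) h := by
      refine eq_of_norm_add_eq_two hh.le (by rw [norm_smul, hεn, one_mul]; exact hk1) ?_
      rw [← h2, ← hx]; simp
    conv_rhs => rw [this, smul_smul, hεε, one_smul]
  have hl : ∀ l, l ≠ k → π (s l) h = 0 := by
    intro l hlk
    refine eq_zero_of_norm_add_le_one (u := π (s k) h) (by rw [hk, norm_smul, hεn, hh, one_mul])
      ?_ ?_
    · simpa using π.norm_apply_apply_le_one (hadd l hlk) hh
    · simpa using π.norm_apply_apply_le_one (hsub l hlk) hh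
  have he : Orthonormal ℂ (fun _ : Fin 1 => h) :=
    ⟨fun _ => hh, fun i j hij => absurd (Subsingleton.elim i j) hij⟩
  have hmem : h ∈ Submodule.span ℂ (Set.range fun _ : Fin 1 => h) :=
    Submodule.subset_span ⟨0, rfl⟩
  have hin : ∀ l, π (s l) h ∈ Submodule.span ℂ (Set.range fun _ : Fin 1 => h) := by
    intro l
    by_cases hlk : l = k
    · rw [hlk, hk]; exact Submodule.smul_mem _ _ hmem
    · rw [hl l hlk]; exact Submodule.zero_mem _
  obtain ⟨χ, hχ⟩ := StarAlgHom.exists_compression hgen π he <| by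
    rintro _ ⟨l, rfl⟩ j
    rw [(hsa l).star_eq]
    exact ⟨hin l, hin l⟩
  refine ⟨χ, ?_, fun l hlk => ?_⟩
  · rw [hχ, hk, inner_smul_right, inner_self_eq_norm_sq_to_K, hh]; simp
  · rw [hχ, hl l hlk, inner_zero_right]

/-- Contractions `a`, `b k` with vanishing products, incompatible in norm, have the
two-dimensional representations which send them to multiples of the matrix unit `E₀₁`. -/
theorem exists_rep_of_norm_eq_two {ι : Type*} {a : D} {b : ι → D}
    (hgen : (StarAlgebra.adjoin ℂ (insert a (Set.range b))).topologicalClosure = ⊤)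
    (haa : a * a = 0) (hab : ∀ k, a * b k = 0) (hba : ∀ k, b k * a = 0)
    (ha : ‖a‖ ≤ 1) (hb : ∀ k, ‖b k‖ ≤ 1)
    {k : ι} (hadd : ∀ l, l ≠ k → ‖b k + b l‖ ≤ 1) (hsub : ∀ l, l ≠ k → ‖b k - b l‖ ≤ 1)
    {ε : ℂ} (hε : ε = 1 ∨ ε = -1) (h2 : ‖a + ε • b k‖ = 2) :
    ∃ P : D →⋆ₐ[ℂ] CStarMatrix (Fin 2) (Fin 2) ℂ, P a = CStarMatrix.ofMatrix !![0, 1; 0, 0] ∧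
      P (b k) = CStarMatrix.ofMatrix !![0, ε; 0, 0] ∧ ∀ l, l ≠ k → P (b l) = 0 := by
  obtain ⟨H, _, _, _, π, h, hh, hx⟩ := exists_rep_norm_apply_eq (a + ε • b k)
  have hεε : ε * ε = 1 := by rcases hε with rfl | rfl <;> simp
  have hεn : ‖ε‖ = 1 := by rcases hε with rfl | rfl <;> simp
  have hx2 : ‖π a h + ε • π (b k) h‖ = 2 := by rw [← h2, ← hx]; simp
  have ha1 := π.norm_apply_apply_le_one ha hh
  have hk1 := π.norm_apply_apply_le_one (hb k) hh
  have hg : π a h = ε • π (b k) h :=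
    eq_of_norm_add_eq_two ha1 (by rw [norm_smul, hεn, one_mul]; exact hk1) hx2
  have hgn : ‖π a h‖ = 1 := by
    rw [← hg, ← two_smul ℂ, norm_smul] at hx2
    simp at hx2
    linarith
  set g := π a h with hgdef
  have hbk : π (b k) h = ε • g := by rw [hg, smul_smul, hεε, one_smul]
  have hbkn : ‖π (b k) h‖ = 1 := by rw [hbk, norm_smul, hεn, hgn, one_mul]
  have hbl : ∀ l, l ≠ k → π (b l) h = 0 := fun l hlk =>
    eq_zero_of_norm_add_le_one hbkn
      (by simpa using π.norm_apply_apply_le_one (hadd l hlk) hh)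
      (by simpa using π.norm_apply_apply_le_one (hsub l hlk) hh)
  have hπ : ∀ x : D, ‖x‖ ≤ 1 → ‖π x‖ ≤ 1 := fun x hx =>
    (NonUnitalStarAlgHom.norm_apply_le π x).trans hx
  have hasg : π (star a) g = h := by
    rw [map_star]; exact ContinuousLinearMap.star_apply_apply_eq_self (hπ _ ha) hh hgn
  have hbksg : π (star (b k)) g = ε • h := by
    have := ContinuousLinearMap.star_apply_apply_eq_self (hπ _ (hb k)) hh hbkn
    rw [hg, map_smul, map_star, this]
  have hblsg : ∀ l, l ≠ k → π (star (b l)) g = 0 := by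
    intro l hlk
    refine eq_zero_of_norm_add_le_one (u := π (star (b k)) g)
      (by rw [hbksg, norm_smul, hεn, hh, one_mul]) ?_ ?_
    · simpa using π.norm_apply_apply_le_one (x := star (b k + b l))
        (by rw [norm_star]; exact hadd l hlk) hgn
    · simpa using π.norm_apply_apply_le_one (x := star (b k - b l))
        (by rw [norm_star]; exact hsub l hlk) hgn
  have hstar : ∀ x : D, a * x = 0 → π (star x) h = 0 := by
    intro x hx
    rw [← hasg, ← mul_apply_eq_comp, ← map_mul, ← star_mul, hx]; simp
  have hzero : ∀ x : D, x * a = 0 → π x g = 0 := by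
    intro x hx
    rw [hgdef, ← mul_apply_eq_comp, ← map_mul, hx]; simp
  have hgh : ⟪g, h⟫_ℂ = 0 := by
    rw [hgdef, ← ContinuousLinearMap.adjoint_inner_right, ← ContinuousLinearMap.star_eq_adjoint,
      ← map_star, hstar a haa, inner_zero_right]
  have hhg : ⟪h, g⟫_ℂ = 0 := inner_eq_zero_symm.1 hgh
  have he : Orthonormal ℂ ![g, h] := by
    rw [orthonormal_iff_ite]
    intro i j
    fin_cases i <;> fin_cases j <;> simp [hgh, hhg, inner_self_eq_norm_sq_to_K, hgn, hh]
  have mg : g ∈ Submodule.span ℂ (Set.range ![g, h]) := Submodule.subset_span ⟨0, rfl⟩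
  have mh : h ∈ Submodule.span ℂ (Set.range ![g, h]) := Submodule.subset_span ⟨1, rfl⟩
  obtain ⟨P, hP⟩ := StarAlgHom.exists_compression hgen π he <| by
    rintro x (rfl | ⟨l, rfl⟩) j
    · fin_cases j
      · simpa [hzero x haa, hasg] using mh
      · simpa [← hgdef, hstar x haa] using mg
    · by_cases hlk : l = k
      · subst hlk
        fin_cases j
        · simpa [hzero _ (hba l), hbksg] using Submodule.smul_mem _ _ mh
        · simpa [hbk, hstar _ (hab l)] using Submodule.smul_mem _ _ mg
      · fin_cases j
        · simp [hzero _ (hba l), hblsg l hlk]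
        · simp [hbl l hlk, hstar _ (hab l)]
  refine ⟨P, ?_, ?_, fun l hlk => ?_⟩
  · ext i j
    rw [hP]
    fin_cases i <;> fin_cases j <;> simp [hzero a haa, ← hgdef, hgn, hhg]
  · ext i j
    rw [hP]
    fin_cases i <;> fin_cases j <;>
      simp [hzero _ (hba k), hbk, hgn, hhg]
  · ext i j
    rw [hP]
    fin_cases i <;> fin_cases j <;> simp [hzero _ (hba l), hbl l hlk]

end Characters

section Amplification

variable {n A B : Type*} [Fintype n] [DecidableEq n] [CStarAlgebra A] [CStarAlgebra B]

/-- The entrywise amplification of a unital `*`-homomorphism. -/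
def CStarMatrix.mapStarAlgHom (f : A →⋆ₐ[ℂ] B) : CStarMatrix n n A →⋆ₐ[ℂ] CStarMatrix n n B where
  toFun M := M.map f
  map_one' := by
    ext i j
    by_cases h : i = j
    · subst h; simp
    · simp [h]
  map_mul' M N := by ext i j; simp [CStarMatrix.mul_apply]
  map_zero' := by ext i j; simp
  map_add' M N := by ext i j; simp
  commutes' r := by
    ext i j
    by_cases h : i = j
    · subst h; simp [CStarMatrix.algebraMap_apply, AlgHomClass.commutes]
    · simp [CStarMatrix.algebraMap_apply, h]
  map_star' M := by ext i j; simp [CStarMatrix.star_apply, map_star]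

theorem CStarMatrix.mapStarAlgHom_apply (f : A →⋆ₐ[ℂ] B) (M : CStarMatrix n n A) :
    CStarMatrix.mapStarAlgHom f M = M.map f := rfl

theorem CStarMatrix.mapStarAlgHom_injective {f : A →⋆ₐ[ℂ] B} (hf : Function.Injective f) :
    Function.Injective (CStarMatrix.mapStarAlgHom (n := n) f) :=
  CStarMatrix.map_injective hf

/-- An injective `*`-homomorphism reflects positivity. -/
theorem StarAlgHom.nonneg_map_iff [PartialOrder A] [StarOrderedRing A] [PartialOrder B]
    [StarOrderedRing B] {f : A →⋆ₐ[ℂ] B} (hf : Function.Injective f) {x : A} :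
    0 ≤ f x ↔ 0 ≤ x := by
  refine ⟨fun h => ?_, fun h => map_nonneg f h⟩
  have hx : IsSelfAdjoint x := hf (by rw [map_star]; exact (IsSelfAdjoint.of_nonneg h).star_eq)
  rw [StarOrderedRing.nonneg_iff_spectrum_nonneg (R := ℝ) _ (IsSelfAdjoint.of_nonneg h),
    hx.map_spectrum_real f hf] at h
  exact (StarOrderedRing.nonneg_iff_spectrum_nonneg (R := ℝ) _ hx).2 h

/-- The identification of `A` with the `1 × 1` matrices over `A`. -/
def CStarMatrix.oneByOne : A →⋆ₐ[ℂ] CStarMatrix (Fin 1) (Fin 1) A where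
  toFun x := CStarMatrix.ofMatrix (Matrix.of fun _ _ => x)
  map_one' := by ext i j; simp [CStarMatrix.one_apply, Subsingleton.elim i j]
  map_mul' x y := by ext i j; simp [CStarMatrix.mul_apply]
  map_zero' := by ext i j; simp
  map_add' x y := by ext i j; simp
  commutes' r := by
    ext i j
    simp [CStarMatrix.algebraMap_apply, Subsingleton.elim i j]
  map_star' x := by ext i j; simp [CStarMatrix.star_apply]

theorem CStarMatrix.oneByOne_injective :
    Function.Injective (CStarMatrix.oneByOne : A →⋆ₐ[ℂ] CStarMatrix (Fin 1) (Fin 1) A) :=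
  fun _ _ h => congrFun (congrFun h 0) 0

variable [PartialOrder A] [StarOrderedRing A] [PartialOrder B] [StarOrderedRing B]

theorem CStarMatrix.nonneg_map_iff {f : A →⋆ₐ[ℂ] B} (hf : Function.Injective f)
    {M : CStarMatrix n n A} : 0 ≤ M.map f ↔ 0 ≤ M :=
  StarAlgHom.nonneg_map_iff (CStarMatrix.mapStarAlgHom_injective (n := n) hf)

theorem CStarMatrix.norm_map {f : A →⋆ₐ[ℂ] B} (hf : Function.Injective f)
    (M : CStarMatrix n n A) : ‖M.map f‖ = ‖M‖ :=
  NonUnitalStarAlgHom.norm_map (CStarMatrix.mapStarAlgHom (n := n) f)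
    (CStarMatrix.mapStarAlgHom_injective hf) M

theorem CStarMatrix.norm_ofMatrix_const (x : A) :
    ‖CStarMatrix.ofMatrix (Matrix.of fun _ _ : Fin 1 => x)‖ = ‖x‖ :=
  NonUnitalStarAlgHom.norm_map CStarMatrix.oneByOne CStarMatrix.oneByOne_injective x

theorem CStarMatrix.ofMatrix_const_nonneg_iff {x : A} :
    0 ≤ CStarMatrix.ofMatrix (Matrix.of fun _ _ : Fin 1 => x) ↔ 0 ≤ x := by
  have := StarAlgHom.nonneg_map_iff (x := x) CStarMatrix.oneByOne_injective
  exact this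

end Amplification

section Coordinates

/-- The two eigenvalues of the flip `[0, 1; 1, 0]`. -/
def flipSign : Fin 2 → ℂ := ![1, -1]

theorem flipSign_eq (t : Fin 2) : flipSign t = 1 ∨ flipSign t = -1 := by
  fin_cases t <;> simp [flipSign]

/-- The diagonalization `[a, b; b, a] ↦ (a + b, a - b)` of `ℬ`. -/
noncomputable def algBEquiv : algB ≃⋆ₐ[ℂ] (Fin 2 → ℂ) where
  toFun m t := (m : CStarMatrix (Fin 2) (Fin 2) ℂ) 0 0 +
    flipSign t * (m : CStarMatrix (Fin 2) (Fin 2) ℂ) 0 1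
  invFun f := ⟨CStarMatrix.ofMatrix
    !![(f 0 + f 1) / 2, (f 0 - f 1) / 2; (f 0 - f 1) / 2, (f 0 + f 1) / 2], _, _, rfl⟩
  left_inv := by
    rintro ⟨_, a, b, rfl⟩
    refine Subtype.ext ?_
    ext i j
    fin_cases i <;> fin_cases j <;> simp [flipSign] <;> ring
  right_inv f := by
    ext t
    fin_cases t <;> simp [flipSign] <;> ring
  map_mul' := by
    rintro ⟨_, a, b, rfl⟩ ⟨_, a', b', rfl⟩
    ext t
    fin_cases t <;> simp [flipSign, CStarMatrix.mul_apply] <;> ring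
  map_add' := by
    rintro ⟨_, a, b, rfl⟩ ⟨_, a', b', rfl⟩
    ext t
    fin_cases t <;> simp [flipSign] <;> ring
  map_smul' := by
    rintro r ⟨_, a, b, rfl⟩
    ext t
    fin_cases t <;> simp [flipSign] <;> ring
  map_star' := by
    rintro ⟨_, a, b, rfl⟩
    ext t
    fin_cases t <;> simp [flipSign, CStarMatrix.star_apply]

theorem blockAlg_ext {x y : Fin 3 → algB} (h : ∀ k t, algBEquiv (x k) t = algBEquiv (y k) t) :
    x = y :=
  funext fun k => algBEquiv.injective (funext fun t => h k t)

/-- The flip in the `k`-th summand of `ℬ ⊕ ℬ ⊕ ℬ`. -/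
noncomputable def blockFlip (k : Fin 3) : Fin 3 → algB := Pi.single k (algBEquiv.symm flipSign)

theorem algBEquiv_blockFlip (k l : Fin 3) (t : Fin 2) :
    algBEquiv (blockFlip k l) t = if l = k then flipSign t else 0 := by
  by_cases h : l = k
  · subst h; simp [blockFlip]
  · simp [blockFlip, h]

theorem flipSign_mul_self (t : Fin 2) : flipSign t * flipSign t = 1 := by
  rcases flipSign_eq t with h | h <;> simp [h]

theorem norm_flipSign (t : Fin 2) : ‖flipSign t‖ = 1 := by
  rcases flipSign_eq t with ht | ht <;> simp [ht]

theorem star_flipSign (t : Fin 2) : star (flipSign t) = flipSign t := by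
  rcases flipSign_eq t with h | h <;> simp [h]

theorem isSelfAdjoint_blockFlip (k : Fin 3) : IsSelfAdjoint (blockFlip k) := by
  refine blockAlg_ext fun l t => ?_
  rw [Pi.star_apply, map_star, Pi.star_apply, algBEquiv_blockFlip]
  split_ifs <;> simp [star_flipSign]

theorem blockFlip_mul_of_ne {k l : Fin 3} (h : k ≠ l) : blockFlip k * blockFlip l = 0 := by
  refine blockAlg_ext fun m t => ?_
  rw [Pi.mul_apply, map_mul, Pi.mul_apply, algBEquiv_blockFlip, algBEquiv_blockFlip]
  by_cases h1 : m = k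
  · subst h1; simp [h]
  · simp [h1]

theorem sum_blockFlip_mul_self : ∑ k, blockFlip k * blockFlip k = 1 := by
  refine blockAlg_ext fun m t => ?_
  simp [Finset.sum_apply, algBEquiv_blockFlip, flipSign_mul_self]

theorem blockFlip_mul_sum (k : Fin 3) :
    blockFlip k * ∑ l, blockFlip l = blockFlip k * blockFlip k := by
  rw [Finset.mul_sum]
  exact Finset.sum_eq_single k (fun m _ hm => blockFlip_mul_of_ne hm.symm) (by simp)

theorem sum_blockFlip_mul_sum : (∑ l, blockFlip l) * ∑ l, blockFlip l = 1 := by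
  rw [Finset.sum_mul, ← sum_blockFlip_mul_self]
  exact Finset.sum_congr rfl fun k _ => blockFlip_mul_sum k

theorem blockAlg_decomposition (x : Fin 3 → algB) : ∃ α β : Fin 3 → ℂ,
    x = ∑ k, (α k • (blockFlip k * blockFlip k) + β k • blockFlip k) := by
  refine ⟨fun k => (algBEquiv (x k) 0 + algBEquiv (x k) 1) / 2,
    fun k => (algBEquiv (x k) 0 - algBEquiv (x k) 1) / 2, blockAlg_ext fun m t => ?_⟩
  have : ∀ k, algBEquiv (((algBEquiv (x k) 0 + algBEquiv (x k) 1) / 2) •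
      (blockFlip k * blockFlip k) m + ((algBEquiv (x k) 0 - algBEquiv (x k) 1) / 2) •
        blockFlip k m) t = if m = k then algBEquiv (x k) t else 0 := by
    intro k
    simp only [Pi.mul_apply, map_add, map_smul, map_mul, Pi.add_apply, Pi.smul_apply,
      algBEquiv_blockFlip]
    by_cases h : m = k
    · fin_cases t <;> simp [h, flipSign] <;> ring
    · simp [h]
  simp only [Finset.sum_apply, Pi.add_apply, Pi.smul_apply, map_sum, this]
  simp

theorem coe_blockFlip (k l : Fin 3) : (blockFlip k l : CStarMatrix (Fin 2) (Fin 2) ℂ) =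
    if l = k then CStarMatrix.ofMatrix !![0, 1; 1, 0] else 0 := by
  by_cases h : l = k
  · subst h
    simp only [blockFlip, Pi.single_eq_same, if_true]
    ext i j
    fin_cases i <;> fin_cases j <;> simp [algBEquiv, flipSign]
  · simp [blockFlip, h]

end Coordinates

section Systems

theorem blockIncl_injective : Function.Injective blockIncl := by
  intro x y h
  funext k
  refine Subtype.ext ?_
  ext i j
  have h1 := congrFun (congrFun h (finProdFinEquiv (k, i))) (finProdFinEquiv (k, j))
  have e1 : ∀ (a : Fin 3) (b : Fin 2), (finProdFinEquiv (a, b)).divNat = a := fun a b =>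
    congrArg Prod.fst (finProdFinEquiv.symm_apply_apply (a, b))
  have e2 : ∀ (a : Fin 3) (b : Fin 2), (finProdFinEquiv (a, b)).modNat = b := fun a b =>
    congrArg Prod.snd (finProdFinEquiv.symm_apply_apply (a, b))
  simpa [blockIncl, e1, e2] using h1

theorem blockIncl_combination (a : ℂ) (c : Fin 3 → ℂ) :
    blockIncl (a • 1 + ∑ k, c k • blockFlip k) = CStarMatrix.ofMatrix
    !![a, c 0, 0, 0, 0, 0;
       c 0, a, 0, 0, 0, 0;
       0, 0, a, c 1, 0, 0;
       0, 0, c 1, a, 0, 0;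
       0, 0, 0, 0, a, c 2;
       0, 0, 0, 0, c 2, a] := by
  ext i j
  change (if Fin.divNat (m := 3) (n := 2) i = Fin.divNat (m := 3) (n := 2) j then
    (((a • 1 + ∑ k, c k • blockFlip k) (Fin.divNat (m := 3) (n := 2) i) : algB) :
      CStarMatrix (Fin 2) (Fin 2) ℂ) (Fin.modNat (m := 3) (n := 2) i)
        (Fin.modNat (m := 3) (n := 2) j) else 0) = _
  simp only [Fin.sum_univ_three, Pi.add_apply, Pi.smul_apply, Pi.one_apply,
    AddMemClass.coe_add, SetLike.val_smul, coe_blockFlip]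
  fin_cases i <;> fin_cases j <;> simp [Fin.divNat, Fin.modNat]

theorem mem_W32_iff {x : CStarMatrix (Fin 6) (Fin 6) ℂ} :
    x ∈ W32.toSubmodule ↔
      ∃ (a : ℂ) (c : Fin 3 → ℂ), x = blockIncl (a • 1 + ∑ k, c k • blockFlip k) := by
  simp only [blockIncl_combination]
  constructor
  · rintro ⟨a, b, c, d, rfl⟩
    exact ⟨a, ![b, c, d], rfl⟩
  · rintro ⟨a, c, rfl⟩
    exact ⟨a, c 0, c 1, c 2, rfl⟩

/-- The inclusion of `𝒲₃,₂` into `ℬ ⊕ ℬ ⊕ ℬ`. -/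
noncomputable def W32Incl : W32.toSubmodule →ₗ[ℂ] (Fin 3 → algB) :=
  (LinearEquiv.ofInjective blockIncl.toAlgHom.toLinearMap blockIncl_injective).symm.toLinearMap ∘ₗ
    Submodule.inclusion (p' := LinearMap.range blockIncl.toAlgHom.toLinearMap) (by
      intro x hx
      obtain ⟨a, c, rfl⟩ := mem_W32_iff.1 hx
      exact ⟨_, rfl⟩)

theorem blockIncl_W32Incl (x : W32.toSubmodule) : blockIncl (W32Incl x) = x :=
  congrArg Subtype.val (LinearEquiv.apply_symm_apply
    (LinearEquiv.ofInjective blockIncl.toAlgHom.toLinearMap blockIncl_injective) _)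

theorem exists_W32Incl_eq (a : ℂ) (c : Fin 3 → ℂ) :
    ∃ x, W32Incl x = a • 1 + ∑ k, c k • blockFlip k :=
  ⟨⟨_, mem_W32_iff.2 ⟨a, c, rfl⟩⟩, blockIncl_injective (blockIncl_W32Incl _)⟩

theorem W32Incl_eq (x : W32.toSubmodule) :
    ∃ (a : ℂ) (c : Fin 3 → ℂ), W32Incl x = a • 1 + ∑ k, c k • blockFlip k := by
  obtain ⟨a, c, h⟩ := mem_W32_iff.1 x.2
  exact ⟨a, c, blockIncl_injective (by rw [blockIncl_W32Incl, h])⟩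

theorem blockFlip_mem_range (k : Fin 3) : blockFlip k ∈ Set.range W32Incl := by
  obtain ⟨x, hx⟩ := exists_W32Incl_eq 0 (Pi.single k 1)
  exact ⟨x, by rw [hx]; simp [Pi.single_apply]⟩

theorem eq_top_of_blockFlip_mem {T : StarSubalgebra ℂ (Fin 3 → algB)}
    (h : ∀ k, blockFlip k ∈ T) : T = ⊤ := by
  rw [eq_top_iff]
  intro x _
  obtain ⟨α, β, rfl⟩ := blockAlg_decomposition x
  exact sum_mem fun k _ => add_mem (SMulMemClass.smul_mem _ (mul_mem (h k) (h k)))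
    (SMulMemClass.smul_mem _ (h k))

theorem adjoin_range_W32Incl : StarAlgebra.adjoin ℂ (Set.range W32Incl) = ⊤ :=
  eq_top_of_blockFlip_mem fun k => StarAlgebra.subset_adjoin ℂ _ (blockFlip_mem_range k)

theorem W32Incl_isCStarCover : W32.IsCStarCover W32Incl where
  map_one := blockIncl_injective (by rw [blockIncl_W32Incl, map_one])
  completeOrder n M := by
    rw [← CStarMatrix.nonneg_map_iff blockIncl_injective]
    have : CStarMatrix.map (CStarMatrix.ofMatrix (M.map W32Incl)) blockIncl
        = CStarMatrix.ofMatrix (M.map fun s => (s : CStarMatrix (Fin 6) (Fin 6) ℂ)) := by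
      ext1 i j
      exact blockIncl_W32Incl (M i j)
    rw [this]
  generates := by
    rw [adjoin_range_W32Incl, eq_top_iff]
    exact StarSubalgebra.le_topologicalClosure _

theorem W32Incl_isHyperrigid.{w} : IsHyperrigidSystem.{w} (LinearMap.range W32Incl) := by
  intro H _ _ _ π
  refine ⟨π, fun _ => rfl, fun ψ h1 hψ => CompletelyPositiveMap.eq_of_agreement_eq_top (h1 := h1)
    (eq_top_of_blockFlip_mem fun k => ?_)⟩
  have hs : ∀ k, ψ (blockFlip k) = π (blockFlip k) := fun k =>
    hψ ⟨blockFlip k, blockFlip_mem_range k⟩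
  have husa : IsSelfAdjoint (∑ l, blockFlip l) :=
    isSelfAdjoint_sum _ fun l _ => isSelfAdjoint_blockFlip l
  have hu : ∑ l, blockFlip l ∈ ψ.agreement π h1 :=
    CompletelyPositiveMap.mem_agreement (by simp [hs])
      (by rw [husa.star_eq, sum_blockFlip_mul_sum, h1, map_one])
      (by rw [husa.star_eq, sum_blockFlip_mul_sum, h1, map_one])
  have hp : ψ (blockFlip k * blockFlip k) = π (blockFlip k * blockFlip k) := by
    rw [← blockFlip_mul_sum, (hu.2 _).1, hs, map_mul]
  have hsa := isSelfAdjoint_blockFlip k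
  exact CompletelyPositiveMap.mem_agreement (hs k) (by rw [hsa.star_eq, hp])
    (by rw [hsa.star_eq, hp])

end Systems

section Lifting

/-- The unique entry of a `1 × 1` matrix. -/
def CStarMatrix.entry {A : Type*} [CStarAlgebra A] : CStarMatrix (Fin 1) (Fin 1) A →⋆ₐ[ℂ] A where
  toFun M := M 0 0
  map_one' := by simp
  map_mul' x y := by simp [CStarMatrix.mul_apply]
  map_zero' := by simp
  map_add' x y := by simp
  commutes' r := by simp [CStarMatrix.algebraMap_apply]
  map_star' x := by simp [CStarMatrix.star_apply]

variable {D : Type*} [CStarAlgebra D] {n : ℕ}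

/-- Six matrix representations assemble to a homomorphism into the matrices over `ℬ ⊕ ℬ ⊕ ℬ`. -/
noncomputable def blockLift (P : Fin 3 → Fin 2 → D →⋆ₐ[ℂ] CStarMatrix (Fin n) (Fin n) ℂ) :
    D →⋆ₐ[ℂ] CStarMatrix (Fin n) (Fin n) (Fin 3 → algB) where
  toFun x := CStarMatrix.ofMatrix (Matrix.of fun i j k => algBEquiv.symm fun t => P k t x i j)
  map_one' := by
    ext1 i j
    refine blockAlg_ext fun k t => ?_
    by_cases h : i = j
    · subst h; simp
    · simp [h]
  map_mul' x y := by
    ext1 i j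
    refine blockAlg_ext fun k t => ?_
    simp [CStarMatrix.mul_apply]
  map_zero' := by
    ext1 i j
    refine blockAlg_ext fun k t => ?_
    simp
  map_add' x y := by
    ext1 i j
    refine blockAlg_ext fun k t => ?_
    simp
  commutes' r := by
    ext1 i j
    refine blockAlg_ext fun k t => ?_
    by_cases h : i = j
    · subst h; simp [CStarMatrix.algebraMap_apply, Algebra.algebraMap_eq_smul_one]
    · simp [CStarMatrix.algebraMap_apply, h, Algebra.algebraMap_eq_smul_one]
  map_star' x := by
    ext1 i j
    refine blockAlg_ext fun k t => ?_
    simp [CStarMatrix.star_apply, map_star]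

theorem algBEquiv_blockLift (P : Fin 3 → Fin 2 → D →⋆ₐ[ℂ] CStarMatrix (Fin n) (Fin n) ℂ) (x : D)
    (i j : Fin n) (k : Fin 3) (t : Fin 2) : algBEquiv (blockLift P x i j k) t = P k t x i j := by
  simp [blockLift]

end Lifting

section SystemEnvelope

theorem blockAlg_nonneg_iff {x : Fin 3 → algB} : 0 ≤ x ↔ ∀ k t, 0 ≤ algBEquiv (x k) t := by
  rw [Pi.le_def]
  refine forall_congr' fun k => ?_
  rw [Pi.zero_apply, ← StarAlgHom.nonneg_map_iff (f := (algBEquiv : algB →⋆ₐ[ℂ] (Fin 2 → ℂ)))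
    algBEquiv.injective, Pi.le_def]
  rfl

theorem norm_le_one_of_nonneg {D : Type*} [CStarAlgebra D] [PartialOrder D] [StarOrderedRing D]
    {y : D} (h1 : 0 ≤ 1 + y) (h2 : 0 ≤ 1 - y) : ‖y‖ ≤ 1 := by
  have hy : IsSelfAdjoint y := by
    have := (IsSelfAdjoint.of_nonneg h1).sub (.one D)
    simpa using this
  have h3 : 0 ≤ (1 + y) * (1 - y) :=
    Commute.mul_nonneg h1 h2 (by rw [Commute, SemiconjBy]; noncomm_ring)
  have h4 : star y * y ≤ 1 := by
    rw [← sub_nonneg, hy.star_eq]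
    convert h3 using 1
    noncomm_ring
  have h5 := (CStarAlgebra.norm_le_one_iff_of_nonneg (star y * y)).2 h4
  rw [CStarRing.norm_star_mul_self] at h5
  nlinarith [norm_nonneg y]

/-- The flip in the `k`-th block, as an element of `𝒲₃,₂`. -/
noncomputable def W32Flip (k : Fin 3) : W32.toSubmodule :=
  ⟨blockIncl (blockFlip k), mem_W32_iff.2 ⟨0, Pi.single k 1, by simp [Pi.single_apply]⟩⟩

theorem W32Incl_W32Flip (k : Fin 3) : W32Incl (W32Flip k) = blockFlip k :=
  blockIncl_injective (blockIncl_W32Incl _)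

theorem W32Incl_injective : Function.Injective W32Incl := fun x y h =>
  Subtype.ext (by rw [← blockIncl_W32Incl, h, blockIncl_W32Incl])

theorem W32_eq_combination (x : W32.toSubmodule) : ∃ (a : ℂ) (c : Fin 3 → ℂ),
    x = a • ⟨1, W32.one_mem'⟩ + ∑ k, c k • W32Flip k := by
  obtain ⟨a, c, h⟩ := W32Incl_eq x
  refine ⟨a, c, W32Incl_injective ?_⟩
  simp [h, W32Incl_isCStarCover.map_one, W32Incl_W32Flip]

section Cover

variable {D : Type*} [CStarAlgebra D] [PartialOrder D] [StarOrderedRing D]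
  {ρ : W32.toSubmodule →ₗ[ℂ] D}

theorem OperatorSystem.IsCStarCover.nonneg_iff {A C : Type*} [CStarAlgebra A] [PartialOrder A]
    [StarOrderedRing A] [CStarAlgebra C] [PartialOrder C] [StarOrderedRing C]
    {S : OperatorSystem A} {ρ : S.toSubmodule →ₗ[ℂ] C} (h : S.IsCStarCover ρ) (x : S.toSubmodule) :
    0 ≤ ρ x ↔ 0 ≤ (x : A) := by
  rw [← CStarMatrix.ofMatrix_const_nonneg_iff,
    ← CStarMatrix.ofMatrix_const_nonneg_iff (x := (x : A))]
  exact (h.completeOrder 1 (Matrix.of fun _ _ => x)).symm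

theorem W32_cover_nonneg_iff (h : W32.IsCStarCover ρ) (x : W32.toSubmodule) :
    0 ≤ ρ x ↔ ∀ k t, 0 ≤ algBEquiv (W32Incl x k) t := by
  rw [h.nonneg_iff, ← W32Incl_isCStarCover.nonneg_iff, blockAlg_nonneg_iff]

theorem W32_cover_nonneg_iff_combination (h : W32.IsCStarCover ρ) (a : ℂ) (c : Fin 3 → ℂ) :
    0 ≤ a • 1 + ∑ k, c k • ρ (W32Flip k) ↔ ∀ k t, 0 ≤ a + c k * flipSign t := by
  have h1 : a • 1 + ∑ k, c k • ρ (W32Flip k)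
      = ρ (a • ⟨1, W32.one_mem'⟩ + ∑ k, c k • W32Flip k) := by
    simp [h.map_one]
  rw [h1, W32_cover_nonneg_iff h]
  simp [W32Incl_isCStarCover.map_one, W32Incl_W32Flip, Finset.sum_apply, algBEquiv_blockFlip]

theorem W32_cover_norm_le_one (h : W32.IsCStarCover ρ) {c : Fin 3 → ℝ} (hc : ∀ k, |c k| ≤ 1) :
    ‖∑ k, (c k : ℂ) • ρ (W32Flip k)‖ ≤ 1 := by
  have key : ∀ c : Fin 3 → ℝ, (∀ k, |c k| ≤ 1) →
      0 ≤ (1 : D) + ∑ k, (c k : ℂ) • ρ (W32Flip k) := by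
    intro c hc
    have := W32_cover_nonneg_iff_combination h 1 fun k => (c k : ℂ)
    rw [one_smul] at this
    rw [this]
    intro k t
    have := abs_le.1 (hc k)
    rcases flipSign_eq t with ht | ht
    · rw [ht, mul_one]; exact_mod_cast (by linarith : (0 : ℝ) ≤ 1 + c k)
    · rw [ht]
      have : (0 : ℝ) ≤ 1 + c k * -1 := by linarith
      exact_mod_cast this
  refine norm_le_one_of_nonneg (key c hc) ?_
  have := key (fun k => -c k) (by simpa using hc)
  simpa [sub_eq_add_neg] using this

theorem W32_cover_isSelfAdjoint (h : W32.IsCStarCover ρ) (k : Fin 3) :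
    IsSelfAdjoint (ρ (W32Flip k)) := by
  have h1 := (W32_cover_nonneg_iff_combination h 1 (Pi.single k 1)).2 fun l t => by
    rcases flipSign_eq t with ht | ht <;> by_cases hl : l = k
    · subst hl; simp [ht]; norm_num
    · simp [hl]
    · subst hl; simp [ht]
    · simp [hl]
  have := (IsSelfAdjoint.of_nonneg h1).sub (.one D)
  simpa [Pi.single_apply] using this

theorem W32_cover_nontrivial (h : W32.IsCStarCover ρ) : Nontrivial D := by
  by_contra hD
  rw [not_nontrivial_iff_subsingleton] at hD
  have h1 := (W32_cover_nonneg_iff_combination h (-1) 0).1 (Subsingleton.elim _ _).le 0 0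
  simp at h1
  norm_num at h1

theorem W32_cover_norm_eq_two (h : W32.IsCStarCover ρ) (k : Fin 3) (t : Fin 2) :
    ‖1 + flipSign t • ρ (W32Flip k)‖ = 2 := by
  have := W32_cover_nontrivial h
  have hk : ‖ρ (W32Flip k)‖ ≤ 1 := by
    have := W32_cover_norm_le_one h (c := Pi.single k 1) fun l => by
      by_cases hl : l = k
      · subst hl; simp
      · simp [hl]
    simpa [Pi.single_apply] using this
  refine le_antisymm ?_ ?_
  · refine (norm_add_le _ _).trans ?_
    rw [norm_one, norm_smul, norm_flipSign]
    linarith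
  · set c := ‖1 + flipSign t • ρ (W32Flip k)‖
    have hsa : IsSelfAdjoint (1 + flipSign t • ρ (W32Flip k)) :=
      (IsSelfAdjoint.one D).add (by
        rw [isSelfAdjoint_iff, star_smul, star_flipSign, (W32_cover_isSelfAdjoint h k).star_eq])
    have h1 := sub_nonneg.2 hsa.le_algebraMap_norm_self
    have h2 := (W32_cover_nonneg_iff_combination h (c - 1) (Pi.single k (-flipSign t))).1 (by
      convert h1 using 1
      simp only [Pi.single_apply, ite_smul, zero_smul, Finset.sum_ite_eq', Finset.mem_univ, if_true]
      rw [Algebra.algebraMap_eq_smul_one, ← Complex.coe_smul]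
      module) k t
    rw [Pi.single_eq_same, neg_mul, flipSign_mul_self] at h2
    have h3 := h2.1
    simp at h3
    linarith

theorem W32_range_subset_adjoin (h : W32.IsCStarCover ρ) :
    Set.range ρ ⊆ StarAlgebra.adjoin ℂ (Set.range fun k => ρ (W32Flip k)) := by
  rintro _ ⟨x, rfl⟩
  obtain ⟨a, c, rfl⟩ := W32_eq_combination x
  simp only [map_add, map_smul, h.map_one, map_sum]
  exact add_mem (SMulMemClass.smul_mem _ (one_mem _))
    (sum_mem fun k _ => SMulMemClass.smul_mem _ (StarAlgebra.subset_adjoin ℂ _ ⟨k, rfl⟩))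

theorem W32_cover_exists_hom (h : W32.IsCStarCover ρ) :
    ∃ p : D →⋆ₐ[ℂ] (Fin 3 → algB), ∀ x, p (ρ x) = W32Incl x := by
  have := W32_cover_nontrivial h
  have hgen : (StarAlgebra.adjoin ℂ (Set.range fun k => ρ (W32Flip k))).topologicalClosure = ⊤ := by
    rw [eq_top_iff, ← h.generates]
    exact StarSubalgebra.topologicalClosure_mono
      (StarAlgebra.adjoin_le (W32_range_subset_adjoin h))
  have hpair : ∀ (k l : Fin 3) (r : ℝ), l ≠ k → |r| ≤ 1 →
      ‖ρ (W32Flip k) + (r : ℂ) • ρ (W32Flip l)‖ ≤ 1 := by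
    intro k l r hlk hr
    have := W32_cover_norm_le_one h (c := Pi.single k 1 + Pi.single l r) fun m => by
      by_cases h1 : m = k
      · subst h1; simp [hlk.symm]
      · by_cases h2 : m = l
        · subst h2; simpa [h1] using hr
        · simp [h1, h2]
    simpa [Pi.single_apply, add_smul, Finset.sum_add_distrib, apply_ite (Complex.ofReal)] using this
  have hχ : ∀ k t, ∃ χ : D →⋆ₐ[ℂ] CStarMatrix (Fin 1) (Fin 1) ℂ,
      χ (ρ (W32Flip k)) 0 0 = flipSign t ∧ ∀ l, l ≠ k → χ (ρ (W32Flip l)) 0 0 = 0 := by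
    intro k t
    refine exists_character_of_norm_eq_two (s := fun k => ρ (W32Flip k))
      (W32_cover_isSelfAdjoint h) hgen (fun l => ?_) (fun l hl => ?_) (fun l hl => ?_)
      (flipSign_eq t) (W32_cover_norm_eq_two h k t)
    · obtain ⟨m, hm⟩ := exists_ne l
      simpa using hpair l m 0 hm (by simp)
    · simpa using hpair k l 1 hl (by simp)
    · simpa [sub_eq_add_neg] using hpair k l (-1) hl (by simp)
  choose χ hχ1 hχ2 using hχ
  refine ⟨CStarMatrix.entry.comp (blockLift χ), fun x => ?_⟩
  have hflip : ∀ k, CStarMatrix.entry.comp (blockLift χ) (ρ (W32Flip k)) = blockFlip k := by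
    intro k
    refine blockAlg_ext fun l t => ?_
    rw [algBEquiv_blockFlip]
    refine (algBEquiv_blockLift χ _ 0 0 l t).trans ?_
    by_cases hl : l = k
    · subst hl; simp [hχ1]
    · simp [hl, hχ2 l t k (Ne.symm hl)]
  obtain ⟨a, c, rfl⟩ := W32_eq_combination x
  simp only [map_add, map_smul, map_sum, h.map_one, hflip, W32Incl_W32Flip,
    W32Incl_isCStarCover.map_one, map_one]

end Cover

theorem W32Incl_isCStarEnvelope.{w} : W32.IsCStarEnvelope.{w} W32Incl := by
  refine ⟨W32Incl_isCStarCover, fun D _ _ _ ρ h => ?_⟩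
  obtain ⟨p, hp⟩ := W32_cover_exists_hom h
  refine ⟨p, ⟨?_, hp⟩, fun q hq => StarAlgHom.eq_of_eqOn_generators h.generates ?_⟩
  · refine p.surjective_of_generators_subset_range adjoin_range_W32Incl ?_
    rintro _ ⟨x, rfl⟩
    exact ⟨ρ x, hp x⟩
  · rintro _ ⟨x, rfl⟩
    rw [hq.2, hp]

end SystemEnvelope

section StrictUpper

variable {A : Type*} [CStarAlgebra A]

/-- The strictly upper triangular matrix `[0, x; 0, 0]`. -/
def CStarMatrix.strictUpper : A →ₗ[ℂ] CStarMatrix (Fin 2) (Fin 2) A where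
  toFun x := CStarMatrix.ofMatrix !![0, x; 0, 0]
  map_add' x y := by ext i j; fin_cases i <;> fin_cases j <;> simp
  map_smul' r x := by ext i j; fin_cases i <;> fin_cases j <;> simp

theorem CStarMatrix.strictUpper_apply (x : A) :
    CStarMatrix.strictUpper x = CStarMatrix.ofMatrix !![0, x; 0, 0] := rfl

theorem CStarMatrix.strictUpper_mul (x y : A) :
    CStarMatrix.strictUpper x * CStarMatrix.strictUpper y = 0 := by
  ext i j
  fin_cases i <;> fin_cases j <;> simp [CStarMatrix.strictUpper_apply, CStarMatrix.mul_apply]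

theorem CStarMatrix.strictUpper_mul_star (x y : A) :
    CStarMatrix.strictUpper x * star (CStarMatrix.strictUpper y)
      = CStarMatrix.ofMatrix !![x * star y, 0; 0, 0] := by
  ext i j
  fin_cases i <;> fin_cases j <;>
    simp [CStarMatrix.strictUpper_apply, CStarMatrix.mul_apply, CStarMatrix.star_apply]

/-- The embedding of `A` as the lower right corner of the `2 × 2` matrices. -/
def CStarMatrix.lowerCorner : A →⋆ₙₐ[ℂ] CStarMatrix (Fin 2) (Fin 2) A where
  toFun x := CStarMatrix.ofMatrix !![0, 0; 0, x]
  map_smul' r x := by ext i j; fin_cases i <;> fin_cases j <;> simp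
  map_zero' := by ext i j; fin_cases i <;> fin_cases j <;> simp
  map_add' x y := by ext i j; fin_cases i <;> fin_cases j <;> simp
  map_mul' x y := by
    ext i j; fin_cases i <;> fin_cases j <;> simp [CStarMatrix.mul_apply]
  map_star' x := by
    ext i j; fin_cases i <;> fin_cases j <;> simp [CStarMatrix.star_apply]

theorem CStarMatrix.star_strictUpper_mul (x y : A) :
    star (CStarMatrix.strictUpper x) * CStarMatrix.strictUpper y
      = CStarMatrix.lowerCorner (star x * y) := by
  ext i j
  fin_cases i <;> fin_cases j <;>
    simp [CStarMatrix.strictUpper_apply, CStarMatrix.lowerCorner, CStarMatrix.mul_apply,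
      CStarMatrix.star_apply]

theorem CStarMatrix.strictUpper_one_mul_star_add :
    CStarMatrix.strictUpper (1 : A) * star (CStarMatrix.strictUpper 1) +
      star (CStarMatrix.strictUpper 1) * CStarMatrix.strictUpper 1 = 1 := by
  rw [CStarMatrix.strictUpper_mul_star, CStarMatrix.star_strictUpper_mul]
  ext i j
  fin_cases i <;> fin_cases j <;> simp [CStarMatrix.lowerCorner]

theorem CStarMatrix.norm_strictUpper [PartialOrder A] [StarOrderedRing A] (x : A) :
    ‖CStarMatrix.strictUpper x‖ = ‖x‖ := by
  refine le_antisymm ?_ (CStarMatrix.norm_entry_le_norm (M := CStarMatrix.strictUpper x)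
    (i := 0) (j := 1))
  have h : ‖CStarMatrix.strictUpper x‖ * ‖CStarMatrix.strictUpper x‖ ≤ ‖x‖ * ‖x‖ := by
    rw [← CStarRing.norm_star_mul_self, CStarMatrix.star_strictUpper_mul,
      ← CStarRing.norm_star_mul_self (x := x)]
    exact NonUnitalStarAlgHom.norm_apply_le _ _
  exact abs_le_of_sq_le_sq' (by nlinarith) (norm_nonneg _) |>.2

end StrictUpper

section UpperAlgebra

variable {A : Type*} [CStarAlgebra A]

/-- The inclusion of `X` as the strictly upper triangular part of `𝒰(X)`. -/
noncomputable def upperAlg.ofSpace (X : Submodule ℂ A) : X →ₗ[ℂ] upperAlg X where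
  toFun x := ⟨CStarMatrix.strictUpper (x : A), 0, x, x.2, by
    rw [map_zero]; rfl⟩
  map_add' x y := Subtype.ext (by simp)
  map_smul' r x := Subtype.ext (by simp)

theorem upperAlg.coe_ofSpace {X : Submodule ℂ A} (x : X) :
    (upperAlg.ofSpace X x : CStarMatrix (Fin 2) (Fin 2) A) = CStarMatrix.strictUpper (x : A) := rfl

theorem upperAlg.ofSpace_mul {X : Submodule ℂ A} (x y : X) :
    upperAlg.ofSpace X x * upperAlg.ofSpace X y = 0 :=
  Subtype.ext (CStarMatrix.strictUpper_mul _ _)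

theorem upperAlg.exists_eq {X : Submodule ℂ A} (m : upperAlg X) :
    ∃ (l : ℂ) (x : X), m = algebraMap ℂ _ l + upperAlg.ofSpace X x := by
  obtain ⟨_, l, x, hx, rfl⟩ := m
  refine ⟨l, ⟨x, hx⟩, Subtype.ext ?_⟩
  rw [AddMemClass.coe_add, upperAlg.coe_ofSpace, Subalgebra.coe_algebraMap]
  ext i j
  fin_cases i <;> fin_cases j <;>
    simp [CStarMatrix.algebraMap_apply, CStarMatrix.strictUpper_apply]

theorem IsAlgCStarCover.norm_map [PartialOrder A] [StarOrderedRing A] {C : Type*}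
    [CStarAlgebra C] [PartialOrder C] [StarOrderedRing C] {𝒜 : Subalgebra ℂ A} {ρ : 𝒜 →ₐ[ℂ] C} (h : IsAlgCStarCover 𝒜 ρ) (m : 𝒜) :
    ‖ρ m‖ = ‖(m : A)‖ := by
  rw [← CStarMatrix.norm_ofMatrix_const, ← CStarMatrix.norm_ofMatrix_const (m : A)]
  exact h.completeIsometry 1 (Matrix.of fun _ _ => m)

end UpperAlgebra

section AlgebraInclusion

theorem map_strictUpper_blockIncl (x : Fin 3 → algB) :
    CStarMatrix.mapStarAlgHom blockIncl (CStarMatrix.strictUpper x)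
      = CStarMatrix.strictUpper (blockIncl x) := by
  ext1 i j
  rw [CStarMatrix.mapStarAlgHom_apply]
  fin_cases i <;> fin_cases j <;> simp [CStarMatrix.strictUpper_apply]

/-- The block-diagonal inclusion `M₂(ℬ ⊕ ℬ ⊕ ℬ) ⊆ M₂(M₆(ℂ))`. -/
noncomputable def matrixBlockIncl : CStarMatrix (Fin 2) (Fin 2) (Fin 3 → algB) →ₐ[ℂ]
    CStarMatrix (Fin 2) (Fin 2) (CStarMatrix (Fin 6) (Fin 6) ℂ) :=
  (CStarMatrix.mapStarAlgHom blockIncl).toAlgHom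

theorem matrixBlockIncl_injective : Function.Injective matrixBlockIncl :=
  CStarMatrix.mapStarAlgHom_injective blockIncl_injective

theorem upperAlg_W32_le_range : upperAlg W32.toSubmodule ≤ matrixBlockIncl.range := by
  intro m hm
  obtain ⟨l, x, h⟩ := upperAlg.exists_eq ⟨m, hm⟩
  refine ⟨algebraMap ℂ _ l + CStarMatrix.strictUpper (W32Incl x), ?_⟩
  have h1 : m = algebraMap ℂ _ l + CStarMatrix.strictUpper (x : CStarMatrix (Fin 6) (Fin 6) ℂ) :=
    congrArg Subtype.val h
  have h2 : matrixBlockIncl (CStarMatrix.strictUpper (W32Incl x))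
      = CStarMatrix.strictUpper (x : CStarMatrix (Fin 6) (Fin 6) ℂ) := by
    rw [← blockIncl_W32Incl]; exact map_strictUpper_blockIncl _
  change matrixBlockIncl _ = _
  rw [h1, map_add, AlgHomClass.commutes, h2]

/-- The inclusion of `𝒰(𝒲₃,₂)` into `M₂(ℬ ⊕ ℬ ⊕ ℬ)`. -/
noncomputable def upperIncl :
    upperAlg W32.toSubmodule →ₐ[ℂ] CStarMatrix (Fin 2) (Fin 2) (Fin 3 → algB) :=
  (AlgEquiv.ofInjective matrixBlockIncl matrixBlockIncl_injective).symm.toAlgHom.comp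
    (Subalgebra.inclusion upperAlg_W32_le_range)

theorem matrixBlockIncl_upperIncl (m : upperAlg W32.toSubmodule) :
    matrixBlockIncl (upperIncl m) = m :=
  congrArg Subtype.val (AlgEquiv.apply_symm_apply
    (AlgEquiv.ofInjective matrixBlockIncl matrixBlockIncl_injective) _)

theorem upperIncl_map_blockIncl (m : upperAlg W32.toSubmodule) :
    (upperIncl m).map blockIncl = m :=
  matrixBlockIncl_upperIncl m

theorem upperIncl_ofSpace (x : W32.toSubmodule) :
    upperIncl (upperAlg.ofSpace _ x) = CStarMatrix.strictUpper (W32Incl x) := by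
  refine matrixBlockIncl_injective ?_
  rw [matrixBlockIncl_upperIncl, upperAlg.coe_ofSpace, ← blockIncl_W32Incl]
  exact (map_strictUpper_blockIncl _).symm

theorem eq_top_of_strictUpper_mem
    {T : StarSubalgebra ℂ (CStarMatrix (Fin 2) (Fin 2) (Fin 3 → algB))}
    (h1 : CStarMatrix.strictUpper 1 ∈ T) (hs : ∀ k, CStarMatrix.strictUpper (blockFlip k) ∈ T) :
    T = ⊤ := by
  have hcorner : ∀ x, CStarMatrix.ofMatrix !![x, 0; 0, 0] ∈ T := by
    have e : ∀ x : Fin 3 → algB, CStarMatrix.strictUpper x * star (CStarMatrix.strictUpper 1)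
        = CStarMatrix.ofMatrix !![x, 0; 0, 0] := fun x => by
      rw [CStarMatrix.strictUpper_mul_star, star_one, mul_one]
    intro x
    obtain ⟨α, β, rfl⟩ := blockAlg_decomposition x
    rw [← e, map_sum, Finset.sum_mul]
    refine sum_mem fun k _ => ?_
    rw [map_add, map_smul, map_smul, add_mul, Algebra.smul_mul_assoc, Algebra.smul_mul_assoc]
    refine add_mem (SMulMemClass.smul_mem _ ?_)
      (SMulMemClass.smul_mem _ (mul_mem (hs k) (star_mem h1)))
    have e2 : CStarMatrix.strictUpper (blockFlip k * blockFlip k)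
        * star (CStarMatrix.strictUpper 1)
        = CStarMatrix.strictUpper (blockFlip k) * star (CStarMatrix.strictUpper (blockFlip k)) := by
      rw [e, CStarMatrix.strictUpper_mul_star, (isSelfAdjoint_blockFlip k).star_eq]
    rw [e2]
    exact mul_mem (hs k) (star_mem (hs k))
  rw [eq_top_iff]
  intro m _
  have hm : m = CStarMatrix.ofMatrix !![m 0 0, 0; 0, 0]
      + CStarMatrix.ofMatrix !![m 0 1, 0; 0, 0] * CStarMatrix.strictUpper 1
      + star (CStarMatrix.strictUpper 1) * CStarMatrix.ofMatrix !![m 1 0, 0; 0, 0]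
      + star (CStarMatrix.strictUpper 1) * CStarMatrix.ofMatrix !![m 1 1, 0; 0, 0]
        * CStarMatrix.strictUpper 1 := by
    ext1 i j
    fin_cases i <;> fin_cases j <;>
      simp [CStarMatrix.strictUpper_apply, CStarMatrix.mul_apply, CStarMatrix.star_apply]
  rw [hm]
  exact add_mem (add_mem (add_mem (hcorner _) (mul_mem (hcorner _) h1))
    (mul_mem (star_mem h1) (hcorner _))) (mul_mem (mul_mem (star_mem h1) (hcorner _)) h1)

theorem strictUpper_one_mem_range : CStarMatrix.strictUpper 1 ∈ Set.range upperIncl :=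
  ⟨upperAlg.ofSpace _ ⟨1, W32.one_mem'⟩, by
    rw [upperIncl_ofSpace, W32Incl_isCStarCover.map_one]⟩

theorem strictUpper_blockFlip_mem_range (k : Fin 3) :
    CStarMatrix.strictUpper (blockFlip k) ∈ Set.range upperIncl :=
  ⟨upperAlg.ofSpace _ (W32Flip k), by rw [upperIncl_ofSpace, W32Incl_W32Flip]⟩

theorem adjoin_range_upperIncl : StarAlgebra.adjoin ℂ (Set.range upperIncl) = ⊤ :=
  eq_top_of_strictUpper_mem (StarAlgebra.subset_adjoin ℂ _ strictUpper_one_mem_range)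
    fun k => StarAlgebra.subset_adjoin ℂ _ (strictUpper_blockFlip_mem_range k)

theorem upperIncl_isAlgCStarCover : IsAlgCStarCover (upperAlg W32.toSubmodule) upperIncl where
  completeIsometry n M := by
    rw [← CStarMatrix.norm_map
      (CStarMatrix.mapStarAlgHom_injective (n := Fin 2) blockIncl_injective)
      (CStarMatrix.ofMatrix (M.map upperIncl))]
    have : CStarMatrix.map (CStarMatrix.ofMatrix (M.map upperIncl))
        (CStarMatrix.mapStarAlgHom (n := Fin 2) blockIncl) = CStarMatrix.ofMatrix (M.map fun s =>
          (s : CStarMatrix (Fin 2) (Fin 2) (CStarMatrix (Fin 6) (Fin 6) ℂ))) := by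
      ext1 i j
      exact matrixBlockIncl_upperIncl (M i j)
    rw [this]
  generates := by
    rw [adjoin_range_upperIncl, eq_top_iff]
    exact StarSubalgebra.le_topologicalClosure _

end AlgebraInclusion

section AlgebraHyperrigidity

theorem upperIncl_isHyperrigid.{w} : IsHyperrigidAlg.{w} upperIncl.range := by
  intro H _ _ _ π
  refine ⟨π, fun _ => rfl, fun ψ hψ h1 hext => ?_⟩
  let Ψ := hψ.toCompletelyPositiveMap h1
  have hΨ1 : Ψ 1 = 1 := h1
  have hrange : ∀ y ∈ Set.range upperIncl, Ψ y = π y := by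
    rintro _ ⟨m, rfl⟩
    exact hext ⟨upperIncl m, m, rfl⟩
  let E : (Fin 3 → algB) →ₗ[ℂ] CStarMatrix (Fin 2) (Fin 2) (Fin 3 → algB) :=
    CStarMatrix.strictUpper
  let u : Fin 3 → algB := ∑ l, blockFlip l
  have hE1 : Ψ (E 1) = π (E 1) := hrange _ strictUpper_one_mem_range
  have hEs : ∀ k, Ψ (E (blockFlip k)) = π (E (blockFlip k)) := fun k =>
    hrange _ (strictUpper_blockFlip_mem_range k)
  have hEu : Ψ (E u) = π (E u) := by simp [u, hEs]
  have hsum : E 1 * star (E 1) + star (E 1) * E 1 = 1 := CStarMatrix.strictUpper_one_mul_star_add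
  have hl : π (star (E 1) * E 1) ≤ Ψ (star (E 1) * E 1) := by
    have := Ψ.schwarz hΨ1 (E 1)
    rwa [hE1, ← map_star, ← map_mul] at this
  have hr : π (E 1 * star (E 1)) ≤ Ψ (E 1 * star (E 1)) := by
    have := Ψ.schwarz_star hΨ1 (E 1)
    rwa [hE1, ← map_star, ← map_mul] at this
  have hadd : π (E 1 * star (E 1)) + π (star (E 1) * E 1)
      = Ψ (E 1 * star (E 1)) + Ψ (star (E 1) * E 1) := by
    rw [← map_add, ← map_add, hsum, map_one, hΨ1]
  have hl' : Ψ (star (E 1) * E 1) = π (star (E 1) * E 1) := by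
    refine le_antisymm ?_ hl
    rw [← add_le_add_iff_left (Ψ (E 1 * star (E 1))), ← hadd]
    exact add_le_add_left hr _
  have hr' : Ψ (E 1 * star (E 1)) = π (E 1 * star (E 1)) := by
    rw [hl'] at hadd
    exact (add_right_cancel hadd).symm
  have hM1 : E 1 ∈ Ψ.agreement π hΨ1 := CompletelyPositiveMap.mem_agreement hE1 hl' hr'
  have husa : star u = u :=
    (isSelfAdjoint_sum _ fun l _ => isSelfAdjoint_blockFlip l : IsSelfAdjoint u).star_eq
  have hsu : ∀ k, blockFlip k * u = blockFlip k * blockFlip k := fun k => blockFlip_mul_sum k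
  have hus : ∀ k, u * blockFlip k = blockFlip k * blockFlip k := fun k => by
    have := congrArg star (hsu k)
    rwa [star_mul, star_mul, husa, (isSelfAdjoint_blockFlip k).star_eq] at this
  have huu : u * u = 1 := sum_blockFlip_mul_sum
  have hMu : E u ∈ Ψ.agreement π hΨ1 := by
    have e1 : star (E u) * E u = star (E 1) * E 1 := by
      simp only [E, CStarMatrix.star_strictUpper_mul, husa, huu, star_one, mul_one]
    have e2 : E u * star (E u) = E 1 * star (E 1) := by
      simp only [E, CStarMatrix.strictUpper_mul_star, husa, huu, star_one, mul_one]
    exact CompletelyPositiveMap.mem_agreement hEu (by rw [e1, hl']) (by rw [e2, hr'])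
  have hMs : ∀ k, E (blockFlip k) ∈ Ψ.agreement π hΨ1 := by
    intro k
    have hsa := (isSelfAdjoint_blockFlip k).star_eq
    have e1 : star (E (blockFlip k)) * E (blockFlip k) = star (E u) * E (blockFlip k) := by
      simp only [E, CStarMatrix.star_strictUpper_mul, husa, hsa, hus]
    have e2 : E (blockFlip k) * star (E (blockFlip k)) = E (blockFlip k) * star (E u) := by
      simp only [E, CStarMatrix.strictUpper_mul_star, husa, hsa, hsu]
    refine CompletelyPositiveMap.mem_agreement (hEs k) ?_ ?_
    · rw [e1, ((star_mem hMu).2 _).2, hEs, map_mul]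
    · rw [e2, ((star_mem hMu).2 _).1, hEs, map_mul]
  exact CompletelyPositiveMap.eq_of_agreement_eq_top (eq_top_of_strictUpper_mem hM1 hMs)

end AlgebraHyperrigidity

section AlgebraEnvelope

theorem blockAlg_norm_le_iff {x : Fin 3 → algB} {r : ℝ} (hr : 0 ≤ r) :
    ‖x‖ ≤ r ↔ ∀ k t, ‖algBEquiv (x k) t‖ ≤ r := by
  rw [pi_norm_le_iff_of_nonneg hr]
  refine forall_congr' fun k => ?_
  rw [← StarAlgEquiv.norm_map algBEquiv (x k), pi_norm_le_iff_of_nonneg hr]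

section Cover

variable {D : Type*} [CStarAlgebra D] [PartialOrder D] [StarOrderedRing D]
  {ρ : upperAlg W32.toSubmodule →ₐ[ℂ] D}

theorem upperAlg_cover_norm (h : IsAlgCStarCover (upperAlg W32.toSubmodule) ρ)
    (x : W32.toSubmodule) : ‖ρ (upperAlg.ofSpace _ x)‖ = ‖W32Incl x‖ := by
  rw [h.norm_map, ← upperIncl_isAlgCStarCover.norm_map, upperIncl_ofSpace,
    CStarMatrix.norm_strictUpper]

theorem algBEquiv_W32Incl_combination (a : ℂ) (c : Fin 3 → ℂ) (k : Fin 3) (t : Fin 2) :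
    algBEquiv (W32Incl (a • ⟨1, W32.one_mem'⟩ + ∑ k, c k • W32Flip k) k) t
      = a + c k * flipSign t := by
  simp [W32Incl_isCStarCover.map_one, W32Incl_W32Flip, Finset.sum_apply, algBEquiv_blockFlip]

theorem upperAlg_cover_norm_le_iff (h : IsAlgCStarCover (upperAlg W32.toSubmodule) ρ) (a : ℂ)
    (c : Fin 3 → ℂ) {r : ℝ} (hr : 0 ≤ r) :
    ‖a • ρ (upperAlg.ofSpace _ ⟨1, W32.one_mem'⟩) +
      ∑ k, c k • ρ (upperAlg.ofSpace _ (W32Flip k))‖ ≤ r ↔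
    ∀ k t, ‖a + c k * flipSign t‖ ≤ r := by
  have h1 : a • ρ (upperAlg.ofSpace _ ⟨1, W32.one_mem'⟩) +
      ∑ k, c k • ρ (upperAlg.ofSpace _ (W32Flip k))
      = ρ (upperAlg.ofSpace _ (a • ⟨1, W32.one_mem'⟩ + ∑ k, c k • W32Flip k)) := by
    simp only [map_add, map_smul, map_sum]
  rw [h1, upperAlg_cover_norm h, blockAlg_norm_le_iff hr]
  simp only [algBEquiv_W32Incl_combination]

theorem upperAlg_cover_exists_hom (h : IsAlgCStarCover (upperAlg W32.toSubmodule) ρ) :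
    ∃ p : D →⋆ₐ[ℂ] CStarMatrix (Fin 2) (Fin 2) (Fin 3 → algB), ∀ m, p (ρ m) = upperIncl m := by
  set a := ρ (upperAlg.ofSpace _ ⟨1, W32.one_mem'⟩) with ha
  set b : Fin 3 → D := fun k => ρ (upperAlg.ofSpace _ (W32Flip k)) with hb
  have hnorm : ∀ (z : ℂ) (c : Fin 3 → ℂ) {r : ℝ}, 0 ≤ r →
      (‖z • a + ∑ k, c k • b k‖ ≤ r ↔ ∀ k t, ‖z + c k * flipSign t‖ ≤ r) :=
    fun z c r hr => upperAlg_cover_norm_le_iff h z c hr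
  have hgen : (StarAlgebra.adjoin ℂ (insert a (Set.range b))).topologicalClosure = ⊤ := by
    rw [eq_top_iff, ← h.generates]
    refine StarSubalgebra.topologicalClosure_mono (StarAlgebra.adjoin_le ?_)
    rintro _ ⟨m, rfl⟩
    obtain ⟨l, x, rfl⟩ := upperAlg.exists_eq m
    obtain ⟨z, c, rfl⟩ := W32_eq_combination x
    simp only [map_add, map_smul, map_sum, AlgHomClass.commutes]
    refine add_mem (algebraMap_mem _ _) (add_mem (SMulMemClass.smul_mem _ ?_)
      (sum_mem fun k _ => SMulMemClass.smul_mem _ ?_))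
    · exact StarAlgebra.subset_adjoin ℂ _ (Set.mem_insert _ _)
    · exact StarAlgebra.subset_adjoin ℂ _ (Set.mem_insert_of_mem _ ⟨k, rfl⟩)
  have hmul : ∀ x y, ρ (upperAlg.ofSpace _ x) * ρ (upperAlg.ofSpace _ y) = 0 := by
    intro x y
    rw [← map_mul, upperAlg.ofSpace_mul, map_zero]
  have ha1 : ‖a‖ ≤ 1 := by simpa using hnorm 1 0 zero_le_one
  have hpair : ∀ (k l : Fin 3) (r : ℂ), l ≠ k → ‖r‖ ≤ 1 → ‖b k + r • b l‖ ≤ 1 := by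
    intro k l r hlk hr
    have := (hnorm 0 (Pi.single k 1 + Pi.single l r) zero_le_one).2 fun m t => by
      rw [zero_add, norm_mul, norm_flipSign, mul_one]
      by_cases h1 : m = k
      · subst h1; simp [hlk.symm]
      · by_cases h2 : m = l
        · subst h2; simpa [h1] using hr
        · simp [h1, h2]
    simpa [Pi.single_apply, add_smul, Finset.sum_add_distrib] using this
  have hb1 : ∀ k, ‖b k‖ ≤ 1 := fun k => by
    obtain ⟨m, hm⟩ := exists_ne k
    simpa using hpair k m 0 hm (by simp)
  have htwo : ∀ k t, ‖a + flipSign t • b k‖ = 2 := by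
    intro k t
    have key : ∀ {r : ℝ}, 0 ≤ r → ‖a + flipSign t • b k‖ ≤ r → 2 ≤ r := by
      intro r hr hle
      have := (hnorm 1 (Pi.single k (flipSign t)) hr).1
        (by simpa [Pi.single_apply] using hle) k t
      rw [Pi.single_eq_same, flipSign_mul_self] at this
      norm_num at this
      exact this
    refine le_antisymm ((norm_add_le _ _).trans ?_) (key (norm_nonneg _) le_rfl)
    rw [norm_smul, norm_flipSign]
    linarith [hb1 k]
  have : Nontrivial D := ⟨_, 0, fun h0 : a + flipSign 0 • b 0 = 0 => by
    have := htwo 0 0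
    rw [h0, norm_zero] at this
    norm_num at this⟩
  have hP := fun k t => exists_rep_of_norm_eq_two (b := b) hgen (hmul _ _) (fun _ => hmul _ _)
    (fun _ => hmul _ _) ha1 hb1 (k := k)
    (fun l hl => by simpa using hpair k l 1 hl (by simp))
    (fun l hl => by simpa [sub_eq_add_neg] using hpair k l (-1) hl (by simp))
    (flipSign_eq t) (htwo k t)
  choose P hPa hPb hPz using hP
  have hpa : blockLift P a = CStarMatrix.strictUpper 1 := by
    ext1 i j
    refine blockAlg_ext fun l t => ?_
    rw [algBEquiv_blockLift, hPa]
    fin_cases i <;> fin_cases j <;> simp [CStarMatrix.strictUpper_apply]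
  have hpb : ∀ k, blockLift P (b k) = CStarMatrix.strictUpper (blockFlip k) := by
    intro k
    ext1 i j
    refine blockAlg_ext fun l t => ?_
    rw [algBEquiv_blockLift]
    by_cases hl : l = k
    · subst hl
      rw [hPb]
      fin_cases i <;> fin_cases j <;> simp [CStarMatrix.strictUpper_apply, algBEquiv_blockFlip]
    · rw [hPz l t k (Ne.symm hl)]
      fin_cases i <;> fin_cases j <;> simp [CStarMatrix.strictUpper_apply, algBEquiv_blockFlip, hl]
  refine ⟨blockLift P, fun m => ?_⟩
  have hspace : ∀ x, blockLift P (ρ (upperAlg.ofSpace _ x))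
      = CStarMatrix.strictUpper (W32Incl x) := by
    intro x
    obtain ⟨z, c, rfl⟩ := W32_eq_combination x
    simp only [map_add, map_smul, map_sum, ← ha, W32Incl_isCStarCover.map_one, W32Incl_W32Flip,
      hpa, ← hpb, hb]
  obtain ⟨l, x, rfl⟩ := upperAlg.exists_eq m
  rw [map_add ρ, map_add (blockLift P), map_add upperIncl, upperIncl_ofSpace, hspace,
    AlgHomClass.commutes ρ, AlgHomClass.commutes (blockLift P), AlgHomClass.commutes upperIncl]

end Cover

theorem upperIncl_isAlgCStarEnvelope.{w} :
    IsAlgCStarEnvelope.{w} (upperAlg W32.toSubmodule) upperIncl := by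
  refine ⟨upperIncl_isAlgCStarCover, fun D _ _ _ ρ h => ?_⟩
  obtain ⟨p, hp⟩ := upperAlg_cover_exists_hom h
  refine ⟨p, ⟨?_, hp⟩, fun q hq => StarAlgHom.eq_of_eqOn_generators h.generates ?_⟩
  · refine p.surjective_of_generators_subset_range adjoin_range_upperIncl ?_
    rintro _ ⟨x, rfl⟩
    exact ⟨ρ x, hp x⟩
  · rintro _ ⟨x, rfl⟩
    rw [hq.2, hp]

end AlgebraEnvelope

theorem mainTheorem7 :
    Nonempty (algB ≃⋆ₐ[ℂ] (Fin 2 → ℂ)) ∧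
    (∃ j : upperAlg W32.toSubmodule →ₐ[ℂ] CStarMatrix (Fin 2) (Fin 2) (Fin 3 → algB),
      (∀ m : upperAlg W32.toSubmodule, (j m).map blockIncl = m) ∧
      IsAlgCStarEnvelope.{u} (upperAlg W32.toSubmodule) j ∧
      IsHyperrigidAlg.{v} j.range) ∧
    (∃ i : W32.toSubmodule →ₗ[ℂ] (Fin 3 → algB),
      (∀ x : W32.toSubmodule, blockIncl (i x) = x) ∧
      W32.IsCStarEnvelope.{u} i ∧
      IsHyperrigidSystem.{v} (LinearMap.range i)) :=
  ⟨⟨algBEquiv⟩,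
    ⟨upperIncl, upperIncl_map_blockIncl, upperIncl_isAlgCStarEnvelope, upperIncl_isHyperrigid⟩,
    ⟨W32Incl, blockIncl_W32Incl, W32Incl_isCStarEnvelope, W32Incl_isHyperrigid⟩⟩
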